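/- All graphs are finite and simple. Let $\mathfrak{B}$ be the class of all cubic, $3$-connected, planar, bipartite graphs. For a graph $G$ and $X\subseteq V(G)$, the cut $\partial(X)\subseteq E(G)$ around $X$ is the set of all edges of $G$ with exactly one end in $X$; its shores are $X$ and $V(G)\setminus X$. A cut is tight if it contains exactly one edge of every perfect matching of $G$, and it is non-trivial if both of its shores have at least two vertices. Two cuts are laminar if for a suitable choice of a shore $X$ of the first and a shore $Y$ of the second we have $X\subseteq Y$ or $Y\subseteq X$. (i) Let $G\in\mathfrak{B}$ have $n$ vertices, and let $\mathcal F$ be an inclusion-wise maximal family of non-trivial, pairwise laminar tight cuts of $G$, where cuts are regarded as sets of edges. Then $|\mathcal F|\le \frac{n-8}{6}$. (ii) This bound is sharp: it is attained by a single cube-expansion of the cube. Here a cube-expansion of a cubic graph at a vertex $v$ replaces $v$ by the cube with one vertex removed and attaches the three edges at $v$ to the three vertices of degree two of the latter, one to each. Every cube-expansion $H$ of the cube at one of its vertices lies in $\mathfrak{B}$ and has an inclusion-wise maximal family $\mathcal F$ of non-trivial, pairwise laminar tight cuts with $|\mathcal F|=\frac{|V(H)|-8}{6}$. -/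

import Mathlib

namespace Barnette

variable {V : Type*}

/-- `G` is `k`-connected: it has more than `k` vertices, and deleting any set of fewer than `k`
vertices leaves a connected graph. -/
def IsKConnected (k : ℕ) (G : SimpleGraph V) : Prop :=
  (k : ℕ∞) < ENat.card V ∧ ∀ S : Set V, S.encard < (k : ℕ∞) → (G.induce Sᶜ).Connected

/-- `G` is planar: it can be drawn in the plane `ℝ × ℝ`, with distinct points `pt v` for the
vertices and simple arcs `arc s(u, v)` from `pt u` to `pt v` for the edges `uv`, in such a way that
the only vertices on the arc of an edge are its two ends, and the arcs of two distinct edges meet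
only in the points of common end vertices. -/
def IsPlanar (G : SimpleGraph V) : Prop :=
  ∃ (pt : V → ℝ × ℝ) (arc : Sym2 V → Set (ℝ × ℝ)),
    Function.Injective pt ∧
    (∀ u v, G.Adj u v →
      ∃ γ : Path (pt u) (pt v), Function.Injective γ ∧ Set.range γ = arc s(u, v)) ∧
    (∀ e ∈ G.edgeSet, ∀ w, pt w ∈ arc e → w ∈ e) ∧
    (∀ e ∈ G.edgeSet, ∀ f ∈ G.edgeSet, e ≠ f → arc e ∩ arc f ⊆ pt '' {w | w ∈ e ∧ w ∈ f})

/-- The class of cubic, 3-connected, planar, bipartite graphs (on finite vertex sets). -/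
structure InBarnetteClass (G : SimpleGraph V) : Prop where
  finite : Finite V
  cubic : ∀ v, (G.neighborSet v).ncard = 3
  threeConnected : IsKConnected 3 G
  planar : IsPlanar G
  bipartite : G.IsBipartite

/-- The cut around `X`: the edges with exactly one end in `X`. -/
def cutAround (G : SimpleGraph V) (X : Set V) : Set (Sym2 V) :=
  {e | ∃ u v, G.Adj u v ∧ u ∈ X ∧ v ∉ X ∧ e = s(u, v)}

/-- A set of edges is a tight cut if it is a cut that contains exactly one edge of each
perfect matching. -/
def IsTightCut (G : SimpleGraph V) (C : Set (Sym2 V)) : Prop :=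
  (∃ X : Set V, C = cutAround G X) ∧
    ∀ M : G.Subgraph, M.IsPerfectMatching → (C ∩ M.edgeSet).ncard = 1

/-- A cut is non-trivial if both of its shores have at least two vertices. -/
def IsNontrivialCut (G : SimpleGraph V) (C : Set (Sym2 V)) : Prop :=
  ∃ X : Set V, C = cutAround G X ∧ X.Nontrivial ∧ Xᶜ.Nontrivial

/-- Two cuts are laminar if, for a suitable choice of one shore of each, one of these shores
contains the other. -/
def Laminar (G : SimpleGraph V) (C D : Set (Sym2 V)) : Prop :=
  ∃ X Y : Set V, C = cutAround G X ∧ D = cutAround G Y ∧ (X ⊆ Y ∨ Y ⊆ X)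

/-- `F` is a family of non-trivial, pairwise laminar tight cuts of `G`. -/
def IsLaminarTightFamily (G : SimpleGraph V) (F : Set (Set (Sym2 V))) : Prop :=
  (∀ C ∈ F, IsTightCut G C ∧ IsNontrivialCut G C) ∧ F.Pairwise (Laminar G)

/-- `F` is an inclusion-wise maximal family of non-trivial, pairwise laminar tight cuts. -/
def IsMaximalLaminarTightFamily (G : SimpleGraph V) (F : Set (Set (Sym2 V))) : Prop :=
  Maximal (IsLaminarTightFamily G) F

/-- The cube: binary strings of length three, adjacent if they differ in exactly one place. -/
def cube : SimpleGraph (Fin 3 → Bool) where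
  Adj x y := ∃! i, x i ≠ y i
  symm := ⟨fun _ _ ⟨i, hi, hu⟩ => ⟨i, hi.symm, fun j hj => hu j (Ne.symm hj)⟩⟩
  loopless := ⟨fun _ ⟨_, hi, _⟩ => hi rfl⟩

/-- The seven vertices that replace a vertex in a cube-expansion: a cube with one vertex removed. -/
inductive Gadget where
  | centre : Gadget
  | inner (i : Fin 3) : Gadget
  | outer (i : Fin 3) : Gadget

/-- Adjacency in the cube with one vertex removed. The centre is joined to the three inner vertices,
and the inner and outer vertices form a hexagon, in which `inner i` is opposite to `outer i`. -/
def Gadget.Adj : Gadget → Gadget → Prop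
  | .centre, .inner _ => True
  | .inner _, .centre => True
  | .inner i, .outer j => i ≠ j
  | .outer i, .inner j => i ≠ j
  | _, _ => False

/-- The cube-expansion of `G` at the vertex `v` of degree three, whose neighbours are numbered by
`σ`: the vertex `v` is replaced by a cube with one vertex removed, and the three edges at `v` are
attached to its three outer vertices (those of degree two), one to each. -/
def cubeExpansion (G : SimpleGraph V) (v : V) (σ : G.neighborSet v ≃ Fin 3) :
    SimpleGraph ({w : V // w ≠ v} ⊕ Gadget) where
  Adj
    | .inl x, .inl y => G.Adj x y
    | .inl x, .inr g => ∃ i, g = .outer i ∧ (σ.symm i : V) = x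
    | .inr g, .inl x => ∃ i, g = .outer i ∧ (σ.symm i : V) = x
    | .inr g, .inr h => g.Adj h
  symm := ⟨by
    rintro (x | g) (y | h) H
    · exact G.adj_symm H
    · exact H
    · exact H
    · cases g <;> cases h <;> simp_all [Gadget.Adj, eq_comm]⟩
  loopless := ⟨by
    rintro (x | g) H
    · exact G.irrefl H
    · cases g <;> simp_all [Gadget.Adj]⟩

end Barnette

/-! A tight cut of a cubic bipartite graph has exactly three edges. Indeed, one third of the
adjacency matrix is doubly stochastic, so by Birkhoff's theorem it is a convex combination of
permutation matrices. Each permutation involved moves every vertex along an edge, hence consists of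
two perfect matchings, crosses the cut twice, and leaves a given shore exactly once. The entries
from the shore to its complement therefore sum to 1, which is a third of the number of cut edges
(`cutSize_eq_three_of_isTightCut`).

Contracting disjoint shores of three-edge cuts keeps the graph cubic and bipartite. As long as at
least three parts remain, 3-edge-connectivity also keeps it simple. A cubic bipartite simple graph
with fewer than eight vertices contains `K₃,₃`; as the shores are connected, this would be a `K₃,₃`
minor of a planar graph. So every such contraction has at least eight vertices
(`eight_le_card_parts`).

The bound follows by induction on the family (`card_laminar_le`). Contract an inclusion-minimal
shore `X` on one side and its complement on the other. The two graphs have together two more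
vertices than the original one. The first carries the remaining cuts, the second has at least eight
vertices, so each cut costs six vertices.

For sharpness, every cube-expansion of the cube is isomorphic to one explicit graph on 14 vertices,
for which membership in the class is checked by computation. The cut around the gadget is tight by
counting, and the bound itself allows no second cut, so this single cut is a maximal family.

That `K₃,₃` has no planar drawing is proved with continuous logarithms in place of the Jordan curve
theorem or Euler's formula. -/

namespace Barnette

/-! ### Non-planarity of `K₃,₃` via winding numbers, and planar minors -/

open Complex in
/-- A continuous nonvanishing function on a simply connected space has a continuous logarithm. -/
theorem exists_continuous_log {X : Type*} [TopologicalSpace X] [SimplyConnectedSpace X]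
    [LocallyPathConnectedSpace X] {g : X → ℂ} (hg : Continuous g) (h0 : ∀ x, g x ≠ 0) :
    ∃ f : X → ℂ, Continuous f ∧ ∀ x, exp (f x) = g x := by
  obtain ⟨x₀⟩ : Nonempty X := inferInstance
  obtain ⟨f, ⟨-, hf⟩, -⟩ := isCoveringMapOn_exp.existsUnique_continuousMap_lifts
    (⟨g, hg⟩ : C(X, ℂ)) (a₀ := x₀) (exp_log (h0 x₀)) h0
  exact ⟨f, f.continuous, fun x => congrFun hf x⟩

open Complex in
/-- Two continuous logarithms of the same function differ by a constant. -/
theorem sub_eq_sub_of_exp_eq {f g : ℝ → ℂ} (hf : Continuous f) (hg : Continuous g)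
    (h : ∀ s, exp (f s) = exp (g s)) (s t : ℝ) : f t - f s = g t - g s := by
  have key : f = fun r => g r + (f s - g s) := by
    refine isCoveringMap_exp.eq_of_comp_eq hf (by fun_prop) ?_ s (by ring)
    funext r
    refine Subtype.ext ?_
    change exp (f r) = exp (g r + (f s - g s))
    rw [exp_add, exp_sub, h, h, div_self (exp_ne_zero _), mul_one]
  have := congrFun key t
  rw [this]; ring

open Complex in
/-- The change of `log (γ - w)` along a path `γ` avoiding `w` is determined by the ends of `γ`
up to an integral multiple of `2πi`. -/
theorem exists_int_log_change {γ : ℝ → ℂ} (hγ : Continuous γ) {w x y : ℂ} (hw : ∀ s, γ s ≠ w)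
    (hx : exp x = γ 0 - w) (hy : exp y = γ 1 - w) :
    ∃ K : ℤ, ∀ f : ℝ → ℂ, Continuous f → (∀ s, exp (f s) = γ s - w) →
      f 1 - f 0 = y - x + K * (2 * Real.pi * I) := by
  obtain ⟨g, hg, hgexp⟩ := exists_continuous_log (g := fun s => γ s - w)
    (hγ.sub continuous_const)
    (fun s => sub_ne_zero.2 (hw s))
  have h : exp (g 1 - g 0) = exp (y - x) := by
    rw [exp_sub, exp_sub, hgexp, hgexp, hx, hy]
  obtain ⟨K, hK⟩ := exp_eq_exp_iff_exists_int.1 h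
  exact ⟨K, fun f hf hfexp => by
    rw [sub_eq_sub_of_exp_eq hf hg (fun s => by rw [hfexp, hgexp]), hK]⟩

open Complex in
/-- The complete bipartite graph `K₃,₃` has no continuous drawing in the plane in which
the images of independent edges are disjoint. -/
theorem no_drawing_K33 (p q : Fin 3 → ℂ) (γ : Fin 3 → Fin 3 → ℝ → ℂ)
    (hγ : ∀ i j, Continuous (γ i j)) (h0 : ∀ i j, γ i j 0 = p i) (h1 : ∀ i j, γ i j 1 = q j)
    (disj : ∀ i j k l, i ≠ k → j ≠ l → ∀ s t, γ i j s ≠ γ k l t) : False := by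
  -- Any two distinct vertices are ends of two independent edges, so their images differ.
  have hpp : ∀ i k, i ≠ k → p i - p k ≠ 0 := fun i k hik => by
    rw [← h0 i 0, ← h0 k 1]; exact sub_ne_zero.2 (disj _ _ _ _ hik (by decide) _ _)
  have hqq : ∀ j l, j ≠ l → q j - q l ≠ 0 := fun j l hjl => by
    rw [← h1 0 j, ← h1 1 l]; exact sub_ne_zero.2 (disj _ _ _ _ (by decide) hjl _ _)
  have hpq : ∀ i j, p i - q j ≠ 0 := fun i j => by
    rw [← h0 i (j + 1), ← h1 (i + 1) j]
    exact sub_ne_zero.2 (disj _ _ _ _ (by simp) (by simp) _ _)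
  -- Logarithms of the differences are fixed so that reversing a pair `i < k` adds exactly `π i`.
  -- This asymmetry is the source of the constants whose parity gives the contradiction.
  have ha : ∃ a : (Fin 3 → ℂ) → Fin 3 → Fin 3 → ℂ, ∀ r : Fin 3 → ℂ,
      (∀ i k, i ≠ k → r i - r k ≠ 0) →
      (∀ i k, i ≠ k → exp (a r i k) = r i - r k) ∧
        ∀ i k, i < k → a r k i = a r i k + Real.pi * I := by
    refine ⟨fun r i k => if i < k then log (r i - r k) else log (r k - r i) + Real.pi * I,
      fun r hr => ⟨fun i k hik => ?_, fun i k hik => ?_⟩⟩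
    · by_cases h : i < k
      · simp [h, exp_log (hr i k hik)]
      · simp [h, exp_add, exp_log (hr k i hik.symm)]
    · simp [hik, hik.not_gt]
  obtain ⟨a, ha⟩ := ha
  obtain ⟨hpe, hps⟩ := ha p hpp
  obtain ⟨hqe, hqs⟩ := ha q hqq
  set d : Fin 3 → Fin 3 → ℂ := fun i j => log (p i - q j) with hd
  have hde : ∀ i j, exp (d i j) = p i - q j := fun i j => exp_log (hpq i j)
  have hce : ∀ i j, exp (d i j + Real.pi * I) = q j - p i := fun i j => by
    rw [exp_add, hde, exp_pi_mul_I]; ring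
  have hKP : ∀ k i j, ∃ K : ℤ, k ≠ i → ∀ f : ℝ → ℂ, Continuous f →
      (∀ s, exp (f s) = γ i j s - p k) →
      f 1 - f 0 = (d k j + Real.pi * I) - a p i k + K * (2 * Real.pi * I) := fun k i j => by
    by_cases hki : k = i
    · exact ⟨0, fun h => absurd hki h⟩
    · obtain ⟨K, hK⟩ := exists_int_log_change (hγ i j) (w := p k) (x := a p i k)
        (y := d k j + Real.pi * I)
        (fun s => by
          rw [← h0 k (j + 1)]; exact disj _ _ _ _ (Ne.symm hki) (by simp) _ _)
        (by rw [h0, hpe _ _ (Ne.symm hki)]) (by rw [h1, hce])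
      exact ⟨K, fun _ => hK⟩
  have hKQ : ∀ l i j, ∃ K : ℤ, l ≠ j → ∀ f : ℝ → ℂ, Continuous f →
      (∀ s, exp (f s) = γ i j s - q l) →
      f 1 - f 0 = a q j l - d i l + K * (2 * Real.pi * I) := fun l i j => by
    by_cases hlj : l = j
    · exact ⟨0, fun h => absurd hlj h⟩
    · obtain ⟨K, hK⟩ := exists_int_log_change (hγ i j) (w := q l) (x := d i l)
        (y := a q j l)
        (fun s => by
          rw [← h1 (i + 1) l]; exact disj _ _ _ _ (by simp) (Ne.symm hlj) _ _)
        (by rw [h0, hde]) (by rw [h1, hqe _ _ (Ne.symm hlj)])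
      exact ⟨K, fun _ => hK⟩
  choose KP hKP using hKP
  choose KQ hKQ using hKQ
  have two_pi : (2 * Real.pi * I : ℂ) ≠ 0 := two_pi_I_ne_zero
  have main : ∀ i j k l, i < k → j ≠ l → KP k i j + KQ j k l - KQ l i j - KP i k l +
      (if j < l then 1 else 0) = 0 := by
    intro i j k l hik hjl
    -- The difference of two points on independent edges never vanishes, so it has a logarithm on
    -- the whole parameter plane. Its changes along the four sides of the unit square, `e1` to `e4`,
    -- must cancel.
    obtain ⟨L, hL, hLe⟩ := exists_continuous_log (X := ℝ × ℝ)
      (g := fun z => γ i j z.1 - γ k l z.2)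
      (((hγ i j).comp continuous_fst).sub ((hγ k l).comp continuous_snd))
      (fun z => sub_ne_zero.2 (disj _ _ _ _ hik.ne hjl _ _))
    have e1 := hKP k i j hik.ne' (fun s => L (s, 0)) (by fun_prop)
      (fun s => by rw [hLe]; simp [h0])
    have e2 := hKQ j k l hjl (fun t => L (1, t) + Real.pi * I) (by fun_prop)
      (fun s => by rw [exp_add, hLe, exp_pi_mul_I]; simp [h1])
    have e3 := hKQ l i j hjl.symm (fun s => L (s, 1)) (by fun_prop)
      (fun s => by rw [hLe]; simp [h1])
    have e4 := hKP i k l hik.ne (fun t => L (0, t) + Real.pi * I) (by fun_prop)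
      (fun s => by rw [exp_add, hLe, exp_pi_mul_I]; simp [h0])
    have e5 := hps i k hik
    have : ((KP k i j + KQ j k l - KQ l i j - KP i k l +
      (if j < l then 1 else 0) : ℤ) : ℂ) * (2 * Real.pi * I) = 0 := by
      rcases lt_or_gt_of_ne hjl with h | h
      · have e6 := hqs j l h
        simp only [h, if_true]
        push_cast
        linear_combination e3 + e4 - e1 - e2 - e5 - e6
      · have e6 := hqs l j h
        simp only [h.not_gt, if_false]
        push_cast
        linear_combination e3 + e4 - e1 - e2 - e5 + e6
    exact_mod_cast (mul_eq_zero.1 this).resolve_right two_pi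
  -- Add the equations for all 18 pairs of independent edges. Each integer `KP` or `KQ` occurs in
  -- exactly two of them, while the constant 1 occurs in nine, so the sum is odd and cannot vanish.
  have M := fun i k (h : i < k) j l (h' : j ≠ l) => main i j k l h h'
  have m1 := M 0 1 (by decide) 0 1 (by decide)
  have m2 := M 0 1 (by decide) 0 2 (by decide)
  have m3 := M 0 1 (by decide) 1 2 (by decide)
  have m4 := M 0 1 (by decide) 1 0 (by decide)
  have m5 := M 0 1 (by decide) 2 0 (by decide)
  have m6 := M 0 1 (by decide) 2 1 (by decide)
  have m7 := M 0 2 (by decide) 0 1 (by decide)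
  have m8 := M 0 2 (by decide) 0 2 (by decide)
  have m9 := M 0 2 (by decide) 1 2 (by decide)
  have m10 := M 0 2 (by decide) 1 0 (by decide)
  have m11 := M 0 2 (by decide) 2 0 (by decide)
  have m12 := M 0 2 (by decide) 2 1 (by decide)
  have m13 := M 1 2 (by decide) 0 1 (by decide)
  have m14 := M 1 2 (by decide) 0 2 (by decide)
  have m15 := M 1 2 (by decide) 1 2 (by decide)
  have m16 := M 1 2 (by decide) 1 0 (by decide)
  have m17 := M 1 2 (by decide) 2 0 (by decide)
  have m18 := M 1 2 (by decide) 2 1 (by decide)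
  simp (decide := true) only [if_true, if_false] at m1 m2 m3 m4 m5 m6 m7 m8 m9
  simp (decide := true) only [if_true, if_false] at m10 m11 m12 m13 m14 m15 m16 m17 m18
  omega

/-- The part of a drawing that belongs to the subgraph induced on `S`. -/
def drawnOn {V : Type*} (G : SimpleGraph V) (pt : V → ℝ × ℝ) (arc : Sym2 V → Set (ℝ × ℝ))
    (S : Set V) : Set (ℝ × ℝ) :=
  pt '' S ∪ ⋃ e ∈ {e | e ∈ G.edgeSet ∧ ∀ w ∈ e, w ∈ S}, arc e

theorem drawnOn_mono {V : Type*} {G : SimpleGraph V} {pt : V → ℝ × ℝ}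
    {arc : Sym2 V → Set (ℝ × ℝ)} {S T : Set V} (h : S ⊆ T) :
    drawnOn G pt arc S ⊆ drawnOn G pt arc T :=
  Set.union_subset_union (Set.image_mono h)
    (Set.biUnion_subset_biUnion_left fun _ he => ⟨he.1, fun w hw => h (he.2 w hw)⟩)

/-- A planar graph has no `K₃,₃` minor. -/
theorem IsPlanar.no_K33_minor {V : Type*} {G : SimpleGraph V} (hG : IsPlanar G)
    (A B : Fin 3 → Set V) (hA : ∀ i, (G.induce (A i)).Connected)
    (hB : ∀ j, (G.induce (B j)).Connected)
    (hAA : ∀ i k, i ≠ k → Disjoint (A i) (A k)) (hBB : ∀ j l, j ≠ l → Disjoint (B j) (B l))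
    (hAB : ∀ i j, Disjoint (A i) (B j))
    (hadj : ∀ i j, ∃ a ∈ A i, ∃ b ∈ B j, G.Adj a b) : False := by
  obtain ⟨pt, arc, hinj, harc, hpt, hmeet⟩ := hG
  set D := drawnOn G pt arc with hD
  -- A point common to both parts is a vertex or lies on two arcs; either way it yields a vertex in
  -- both `S` and `T`.
  have hdisj : ∀ S T : Set V, Disjoint S T → Disjoint (D S) (D T) := by
    intro S T hST
    rw [Set.disjoint_left] at hST ⊢
    rintro x (⟨s, hs, rfl⟩ | hx) hx'
    · rcases hx' with ⟨t, ht, hst⟩ | hx'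
      · exact hST hs (hinj hst ▸ ht)
      · simp only [Set.mem_iUnion] at hx'
        obtain ⟨e, he, hxe⟩ := hx'
        exact hST hs (he.2 _ (hpt e he.1 s hxe))
    · simp only [Set.mem_iUnion] at hx
      obtain ⟨e, he, hxe⟩ := hx
      rcases hx' with ⟨t, ht, rfl⟩ | hx'
      · exact hST (he.2 _ (hpt e he.1 t hxe)) ht
      · simp only [Set.mem_iUnion] at hx'
        obtain ⟨f, hf, hxf⟩ := hx'
        have hef : e ≠ f := by
          rintro rfl
          induction e with | h u v =>
          exact hST (he.2 u (by simp)) (hf.2 u (by simp))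
        obtain ⟨w, ⟨hw1, hw2⟩, -⟩ := hmeet e he.1 f hf.1 hef ⟨hxe, hxf⟩
        exact hST (he.2 w hw1) (hf.2 w hw2)
  have hjoin : ∀ (S : Set V) u v, u ∈ S → v ∈ S → G.Adj u v → JoinedIn (D S) (pt u) (pt v) := by
    intro S u v hu hv huv
    obtain ⟨γ, -, hγ⟩ := harc u v huv
    refine ⟨γ, fun t => Or.inr ?_⟩
    simp only [Set.mem_iUnion]
    exact ⟨s(u, v), ⟨huv, by simp [hu, hv]⟩, hγ ▸ Set.mem_range_self t⟩
  have hconn : ∀ S : Set V, (G.induce S).Connected → ∀ u v, u ∈ S → v ∈ S →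
      JoinedIn (D S) (pt u) (pt v) := by
    intro S hS u v hu hv
    obtain ⟨w⟩ := hS.preconnected ⟨u, hu⟩ ⟨v, hv⟩
    have : ∀ x y : S, (G.induce S).Walk x y → JoinedIn (D S) (pt x) (pt y) := by
      intro x y w
      induction w with
      | nil => exact JoinedIn.refl (Or.inl ⟨_, Subtype.property _, rfl⟩)
      | cons h _ ih => exact (hjoin S _ _ (Subtype.property _) (Subtype.property _) h).trans ih
    exact this _ _ w
  have hcA : ∀ i, ∃ a, a ∈ A i := fun i => by
    obtain ⟨a⟩ := (hA i).nonempty; exact ⟨a, a.2⟩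
  have hcB : ∀ j, ∃ b, b ∈ B j := fun j => by
    obtain ⟨b⟩ := (hB j).nonempty; exact ⟨b, b.2⟩
  choose p hp using hcA
  choose q hq using hcB
  -- Each branch set is represented by one of its vertices, and the edge `ij` of `K₃,₃` is drawn
  -- inside the part belonging to `A i ∪ B j`. These parts are disjoint for independent edges, which
  -- is all that `no_drawing_K33` requires; the paths may well overlap otherwise.
  have hpath : ∀ i j, JoinedIn (D (A i ∪ B j)) (pt (p i)) (pt (q j)) := by
    intro i j
    obtain ⟨a, ha, b, hb, hab⟩ := hadj i j
    exact (((hconn _ (hA i) _ _ (hp i) ha).mono (drawnOn_mono Set.subset_union_left)).trans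
      (hjoin _ a b (Or.inl ha) (Or.inr hb) hab)).trans
      ((hconn _ (hB j) _ _ hb (hq j)).mono (drawnOn_mono Set.subset_union_right))
  choose γ hγ using hpath
  set φ := Complex.equivRealProdCLM.symm with hφ
  refine no_drawing_K33 (fun i => φ (pt (p i))) (fun j => φ (pt (q j)))
    (fun i j s => φ ((γ i j).extend s)) (fun i j => φ.continuous.comp (γ i j).continuous_extend)
    (fun i j => by simp) (fun i j => by simp) ?_
  intro i j k l hik hjl s t h
  have h' := φ.injective h
  refine Set.disjoint_left.1 (hdisj (A i ∪ B j) (A k ∪ B l) ?_)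
    (hγ i j (Set.projIcc 0 1 zero_le_one s)) ?_
  · simp only [Set.disjoint_union_left, Set.disjoint_union_right]
    exact ⟨⟨hAA i k hik, (hAB k j).symm⟩, hAB i l, hBB j l hjl⟩
  · have h2 := hγ k l (Set.projIcc 0 1 zero_le_one t)
    change (γ i j).extend s ∈ _
    rw [h']
    exact h2

set_option linter.unusedSectionVars false

/-! ### Cuts with three edges -/

section CutSize

variable {V : Type*} [Fintype V] [DecidableEq V] (G : SimpleGraph V) [DecidableRel G.Adj]

/-- The number of ordered pairs of adjacent vertices in `X × Y`. -/
def edgesBetween (X Y : Finset V) : ℕ :=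
  ∑ u ∈ X, ∑ v ∈ Y, if G.Adj u v then 1 else 0

/-- The number of edges in the cut around `X`. -/
def cutSize (X : Finset V) : ℕ := edgesBetween G X Xᶜ

theorem edgesBetween_comm (X Y : Finset V) : edgesBetween G X Y = edgesBetween G Y X := by
  unfold edgesBetween
  rw [Finset.sum_comm]
  simp only [G.adj_comm]

theorem edgesBetween_union_left {X Y : Finset V} (h : Disjoint X Y) (Z : Finset V) :
    edgesBetween G (X ∪ Y) Z = edgesBetween G X Z + edgesBetween G Y Z :=
  Finset.sum_union h

theorem edgesBetween_union_right {X Y : Finset V} (h : Disjoint X Y) (Z : Finset V) :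
    edgesBetween G Z (X ∪ Y) = edgesBetween G Z X + edgesBetween G Z Y := by
  rw [edgesBetween_comm, edgesBetween_union_left G h, edgesBetween_comm, edgesBetween_comm G Y]

theorem edgesBetween_eq_zero {X Y : Finset V} :
    edgesBetween G X Y = 0 ↔ ∀ u ∈ X, ∀ v ∈ Y, ¬ G.Adj u v := by
  simp [edgesBetween]

theorem cutSize_compl (X : Finset V) : cutSize G Xᶜ = cutSize G X := by
  rw [cutSize, compl_compl, edgesBetween_comm, cutSize]

/-- An edge between `X` and `Y` lies in both of their cuts but not in the cut around the union. -/
theorem cutSize_union {X Y : Finset V} (h : Disjoint X Y) :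
    cutSize G (X ∪ Y) + 2 * edgesBetween G X Y = cutSize G X + cutSize G Y := by
  have hX : Xᶜ = Y ∪ (X ∪ Y)ᶜ := by
    ext v
    have : v ∈ X → v ∉ Y := fun h' => Finset.disjoint_left.1 h h'
    simp only [Finset.mem_compl, Finset.mem_union]
    tauto
  have hY : Yᶜ = X ∪ (X ∪ Y)ᶜ := by
    ext v
    have : v ∈ X → v ∉ Y := fun h' => Finset.disjoint_left.1 h h'
    simp only [Finset.mem_compl, Finset.mem_union]
    tauto
  have dX : Disjoint Y (X ∪ Y)ᶜ := by
    rw [Finset.disjoint_left]; intro v; simp +contextual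
  have dY : Disjoint X (X ∪ Y)ᶜ := by
    rw [Finset.disjoint_left]; intro v; simp +contextual
  have e1 : cutSize G X = edgesBetween G X Y + edgesBetween G X (X ∪ Y)ᶜ := by
    rw [cutSize, hX, edgesBetween_union_right G dX]
  have e2 : cutSize G Y = edgesBetween G X Y + edgesBetween G Y (X ∪ Y)ᶜ := by
    rw [cutSize, hY, edgesBetween_union_right G dY, edgesBetween_comm G Y X]
  rw [cutSize, edgesBetween_union_left G h, e1, e2]
  omega

variable {G}

/-- In a 3-edge-connected graph, the shores of a cut with three edges are connected. -/
theorem connected_of_cutSize_eq_three (h3 : ∀ X : Finset V, X.Nonempty → X ≠ Finset.univ →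
    3 ≤ cutSize G X) {X : Finset V} (hX : cutSize G X = 3) :
    (G.induce (X : Set V)).Connected := by
  classical
  have hne : X.Nonempty := by
    rw [Finset.nonempty_iff_ne_empty]
    rintro rfl
    simp [cutSize, edgesBetween] at hX
  have hXu : X ≠ Finset.univ := by
    rintro rfl
    simp [cutSize, edgesBetween] at hX
  obtain ⟨x₀, hx₀⟩ := hne
  have : Nonempty (X : Set V) := ⟨⟨x₀, hx₀⟩⟩
  refine ⟨fun x y => ?_⟩
  by_contra hxy
  -- `Y` is the component of `x` in the induced graph. With no edges from `Y` to the rest of `X`,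
  -- the cuts around these two sets would have three edges in total, but each has at least three.
  set Y := Finset.univ.filter fun v => ∃ h : v ∈ X, (G.induce (X : Set V)).Reachable x ⟨v, h⟩
    with hY
  have hYX : Y ⊆ X := fun v hv => by
    simp only [hY, Finset.mem_filter, Finset.mem_univ, true_and] at hv
    exact hv.1
  have hxY : x.1 ∈ Y := by
    simp only [hY, Finset.mem_filter, Finset.mem_univ, true_and]
    exact ⟨x.2, SimpleGraph.Reachable.refl _⟩
  have hyY : y.1 ∈ X \ Y := by
    simp only [hY, Finset.mem_filter, Finset.mem_univ, true_and, Finset.mem_sdiff]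
    exact ⟨y.2, fun ⟨_, h⟩ => hxy h⟩
  have hno : edgesBetween G Y (X \ Y) = 0 := by
    rw [edgesBetween_eq_zero]
    intro u hu v hv huv
    simp only [hY, Finset.mem_filter, Finset.mem_univ, true_and, Finset.mem_sdiff] at hu hv
    obtain ⟨hu', hr⟩ := hu
    exact hv.2 ⟨hv.1, hr.trans
      (SimpleGraph.Adj.reachable (G := G.induce (X : Set V)) (u := ⟨u, hu'⟩) (v := ⟨v, hv.1⟩) huv)⟩
  have hsum := cutSize_union G (Finset.disjoint_sdiff (s := Y) (t := X))
  rw [Finset.union_sdiff_of_subset hYX, hno, hX] at hsum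
  have h1 := h3 Y ⟨_, hxY⟩ (fun h => hXu (Finset.univ_subset_iff.1 (h ▸ hYX)))
  have h2 := h3 (X \ Y) ⟨_, hyY⟩
    (fun h => hXu (Finset.univ_subset_iff.1 (h ▸ Finset.sdiff_subset)))
  omega

/-- In a cubic bipartite graph, all edges of a cut with three edges leave a given shore from the
same colour class. -/
theorem exists_color_of_cutSize_eq_three (hc : ∀ v, G.degree v = 3) (c : V → Bool)
    (hcol : ∀ u v, G.Adj u v → c u ≠ c v) {X : Finset V} (hX : cutSize G X = 3) :
    ∃ b, ∀ u ∈ X, ∀ v ∉ X, G.Adj u v → c u = b := by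
  set C : Bool → Finset V := fun b => X.filter (c · = b) with hC
  have hd : Disjoint (C true) (C false) := by
    rw [Finset.disjoint_left]; intro v; simp +contextual [hC]
  have hu : C true ∪ C false = X := by
    ext v; cases h : c v <;> simp [hC, h]
  have hdeg : ∀ Y : Finset V, edgesBetween G Y Finset.univ = 3 * Y.card := by
    intro Y
    have : ∀ u, (∑ v, if G.Adj u v then 1 else 0) = 3 := fun u => by
      rw [Finset.sum_boole, ← hc u, ← G.card_neighborFinset_eq_degree, G.neighborFinset_eq_filter]
      simp
    simp [edgesBetween, this, mul_comm]
  have hself : ∀ b, edgesBetween G (C b) (C b) = 0 := fun b => by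
    rw [edgesBetween_eq_zero]
    intro u hu v hv huv
    simp only [hC, Finset.mem_filter] at hu hv
    exact hcol u v huv (hu.2.trans hv.2.symm)
  have hsplit : ∀ Y, edgesBetween G Y Finset.univ =
      edgesBetween G Y (C true) + edgesBetween G Y (C false) + edgesBetween G Y Xᶜ := by
    intro Y
    rw [← Finset.union_compl X, edgesBetween_union_right G disjoint_compl_right]
    congr 1
    rw [← edgesBetween_union_right G hd, hu]
  have e1 := hsplit (C true)
  have e2 := hsplit (C false)
  rw [hdeg, hself] at e1 e2
  rw [edgesBetween_comm G (C false) (C true)] at e2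
  have e3 : edgesBetween G (C true) Xᶜ + edgesBetween G (C false) Xᶜ = 3 := by
    rw [← edgesBetween_union_left G hd, hu]; exact hX
  -- By `e1` and `e2` the numbers of cut edges leaving the two colour classes of `X` are congruent
  -- modulo 3. As their sum is 3, one of them is 0.
  have : edgesBetween G (C true) Xᶜ = 0 ∨ edgesBetween G (C false) Xᶜ = 0 := by omega
  rcases this with h | h
  · refine ⟨false, fun u hu v hv huv => ?_⟩
    rw [edgesBetween_eq_zero] at h
    by_contra hb
    exact h u (by simpa [hC, hu] using hb) v (by simpa using hv) huv
  · refine ⟨true, fun u hu v hv huv => ?_⟩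
    rw [edgesBetween_eq_zero] at h
    by_contra hb
    exact h u (by simpa [hC, hu] using hb) v (by simpa using hv) huv

end CutSize

/-! ### Contractions of shores have at least eight vertices -/

/-- A cubic bipartite simple graph has at least eight vertices or contains `K₃,₃`. -/
theorem eight_le_card_or_K33 {R : Type*} [Fintype R] [DecidableEq R] [Nonempty R]
    (Q : SimpleGraph R) [DecidableRel Q.Adj] (hQ : ∀ r, Q.degree r = 3) (c : R → Bool)
    (hcol : ∀ r s, Q.Adj r s → c r ≠ c s) :
    8 ≤ Fintype.card R ∨ ∃ A B : Fin 3 → R, A.Injective ∧ B.Injective ∧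
      ∀ i j, Q.Adj (A i) (B j) := by
  set C : Bool → Finset R := fun b => Finset.univ.filter (c · = b) with hC
  have hN : ∀ b, ∀ r ∈ C b, Q.neighborFinset r ⊆ C (!b) := by
    intro b r hr s hs
    have := hcol r s (by simpa using hs)
    simp only [hC, Finset.mem_filter, Finset.mem_univ, true_and] at hr ⊢
    subst hr
    revert this
    cases c r <;> cases c s <;> simp
  have hcard : (C true).card + (C false).card = Fintype.card R := by
    rw [← Finset.card_union_of_disjoint, ← Finset.card_univ]
    · congr 1
      ext r; cases h : c r <;> simp [hC, h]
    · rw [Finset.disjoint_left]; intro v; simp +contextual [hC]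
  have hcount : (C true).card * 3 = (C false).card * 3 := by
    refine Finset.card_mul_eq_card_mul (r := Q.Adj) (fun r hr => ?_) (fun r hr => ?_)
    · rw [← hQ r, ← Q.card_neighborFinset_eq_degree]
      congr 1
      ext s
      have := @hN _ r hr s
      simp only [Finset.mem_bipartiteAbove, SimpleGraph.mem_neighborFinset] at this ⊢
      exact ⟨fun h => h.2, fun h => ⟨this h, h⟩⟩
    · rw [← hQ r, ← Q.card_neighborFinset_eq_degree]
      congr 1
      ext s
      have := @hN _ r hr s
      simp only [Finset.mem_bipartiteBelow, SimpleGraph.mem_neighborFinset, Q.adj_comm s r]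
        at this ⊢
      exact ⟨fun h => h.2, fun h => ⟨this h, h⟩⟩
  have hge : 3 ≤ (C true).card := by
    obtain ⟨r⟩ := ‹Nonempty R›
    have h := Finset.card_le_card (hN (c r) r (by simp [hC]))
    rw [Q.card_neighborFinset_eq_degree, hQ] at h
    cases hr : c r <;> simp only [hr, Bool.not_true, Bool.not_false] at h <;> omega
  by_cases h8 : 8 ≤ Fintype.card R
  · exact Or.inl h8
  right
  -- The classes have equal size, at least 3, so fewer than eight vertices means 3 + 3, and every
  -- vertex is adjacent to the whole opposite class.
  have ht : (C true).card = 3 := by omega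
  have hf : (C false).card = 3 := by omega
  set A := (Finset.equivFinOfCardEq ht).symm
  set B := (Finset.equivFinOfCardEq hf).symm
  refine ⟨fun i => A i, fun j => B j, Subtype.val_injective.comp A.injective,
    Subtype.val_injective.comp B.injective, fun i j => ?_⟩
  have h := Finset.eq_of_subset_of_card_le (hN true (A i) (A i).2)
    (by rw [Q.card_neighborFinset_eq_degree, hQ]; exact hf.le)
  have hB : (B j : R) ∈ Q.neighborFinset (A i) := by
    rw [h]; exact (B j).2
  simpa using hB

/-- If the vertices of a planar, cubic, bipartite, 3-edge-connected graph are partitioned into at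
least three shores of cuts with three edges, then the partition has at least eight parts. -/
theorem eight_le_card_parts {V : Type*} [Fintype V] [DecidableEq V] {G : SimpleGraph V}
    [DecidableRel G.Adj] (hG : IsPlanar G) (hc : ∀ v, G.degree v = 3) (c : V → Bool)
    (hcol : ∀ u v, G.Adj u v → c u ≠ c v)
    (h3 : ∀ X : Finset V, X.Nonempty → X ≠ Finset.univ → 3 ≤ cutSize G X)
    {R : Type*} [Fintype R] [DecidableEq R] (f : V → R) (hf : f.Surjective)
    (hcut : ∀ r, cutSize G (Finset.univ.filter (f · = r)) = 3) (hR : 3 ≤ Fintype.card R) :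
    8 ≤ Fintype.card R := by
  classical
  have : Nonempty R := Fintype.card_pos_iff.1 (by omega)
  set P : R → Finset V := fun r => Finset.univ.filter (f · = r) with hP
  have hPd : ∀ r s, r ≠ s → Disjoint (P r) (P s) := by
    intro r s hrs
    rw [Finset.disjoint_left]
    intro v hr hs
    simp only [hP, Finset.mem_filter, Finset.mem_univ, true_and] at hr hs
    exact hrs (hr.symm.trans hs)
  -- With `e` edges between two parts, the cut around their union has `6 - 2e` edges. A third part
  -- makes this union proper, so the number is at least 3 and `e ≤ 1`: the quotient is simple.
  have hle : ∀ r s, r ≠ s → edgesBetween G (P r) (P s) ≤ 1 := by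
    intro r s hrs
    have h1 := cutSize_union G (hPd r s hrs)
    rw [hcut, hcut] at h1
    obtain ⟨t, ht⟩ : ∃ t, t ∉ ({r, s} : Finset R) := by
      by_contra! h
      have := Finset.card_le_card (fun x _ => h x : (Finset.univ : Finset R) ⊆ {r, s})
      rw [Finset.card_univ] at this
      have := Finset.card_le_two (a := r) (b := s)
      omega
    simp only [Finset.mem_insert, Finset.mem_singleton, not_or] at ht
    obtain ⟨v, rfl⟩ := hf t
    obtain ⟨u, rfl⟩ := hf r
    have h2 := h3 (P (f u) ∪ P s) ⟨u, by simp [hP]⟩ (fun h => by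
      have : v ∈ P (f u) ∪ P s := h ▸ Finset.mem_univ v
      simp only [hP, Finset.mem_union, Finset.mem_filter, Finset.mem_univ, true_and] at this
      tauto)
    omega
  let Q : SimpleGraph R :=
    { Adj := fun r s => r ≠ s ∧ edgesBetween G (P r) (P s) ≠ 0
      symm := ⟨fun r s h => ⟨h.1.symm, by rw [edgesBetween_comm]; exact h.2⟩⟩
      loopless := ⟨fun r h => h.1 rfl⟩ }
  have hQe : ∀ r s, Q.Adj r s → ∃ u v, f u = r ∧ f v = s ∧ G.Adj u v := by
    intro r s h
    have := h.2
    rw [Ne, edgesBetween_eq_zero] at this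
    push Not at this
    obtain ⟨u, hu, v, hv, huv⟩ := this
    exact ⟨u, v, by simpa [hP] using hu, by simpa [hP] using hv, huv⟩
  have hQd : ∀ r, Q.degree r = 3 := by
    intro r
    rw [← hcut r, ← Q.card_neighborFinset_eq_degree, Q.neighborFinset_eq_filter,
      Finset.card_filter]
    have hcompl : (P r)ᶜ = (Finset.univ.erase r).biUnion P := by
      ext v
      simp [hP]
    change _ = edgesBetween G (P r) (P r)ᶜ
    rw [edgesBetween_comm, hcompl, edgesBetween, Finset.sum_biUnion
      (fun s _ t _ hst => hPd s t hst), ← Finset.sum_erase_add _ _ (Finset.mem_univ r)]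
    have hloop : ¬ Q.Adj r r := Q.loopless.irrefl r
    rw [if_neg hloop, add_zero]
    refine Finset.sum_congr rfl fun s hs => ?_
    have hsr : s ≠ r := Finset.ne_of_mem_erase hs
    have h1 := hle s r hsr
    change _ = edgesBetween G (P s) (P r)
    by_cases h : edgesBetween G (P s) (P r) = 0
    · rw [h, if_neg]
      exact fun h' => h'.symm.2 h
    · rw [if_pos (show Q.Adj r s from SimpleGraph.Adj.symm (G := Q) ⟨hsr, h⟩)]
      omega
  -- All edges leaving a part start in one colour class; this colour properly colours the quotient.
  choose col hcolP using fun r => exists_color_of_cutSize_eq_three hc c hcol (hcut r)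
  rcases eight_le_card_or_K33 Q hQd col (fun r s hrs => by
    obtain ⟨u, v, rfl, rfl, huv⟩ := hQe r s hrs
    rw [← hcolP (f u) u (by simp) v (by simpa using hrs.1.symm) huv,
      ← hcolP (f v) v (by simp) u (by simpa using hrs.1) huv.symm]
    exact hcol u v huv) with h | ⟨A, B, hA, hB, hAB⟩
  · exact h
  exfalso
  have hd : ∀ r s, r ≠ s → Disjoint (P r : Set V) (P s) := fun r s hrs =>
    Finset.disjoint_coe.2 (hPd r s hrs)
  refine hG.no_K33_minor (fun i => P (A i)) (fun j => P (B j))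
    (fun i => connected_of_cutSize_eq_three h3 (hcut _))
    (fun i => connected_of_cutSize_eq_three h3 (hcut _))
    (fun i k h => hd _ _ (hA.ne h)) (fun i k h => hd _ _ (hB.ne h))
    (fun i j => hd _ _ (hAB i j).1) (fun i j => ?_)
  obtain ⟨u, v, hu, hv, huv⟩ := hQe _ _ (hAB i j)
  exact ⟨u, by simpa [hP] using hu, v, by simpa [hP] using hv, huv⟩

/-! ### Cuts and their shores -/

section Cuts

variable {V : Type*} {G : SimpleGraph V}

theorem mk_mem_cutAround {X : Set V} {u v : V} :
    s(u, v) ∈ cutAround G X ↔ G.Adj u v ∧ ¬ (u ∈ X ↔ v ∈ X) := by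
  constructor
  · rintro ⟨x, y, hxy, hx, hy, he⟩
    rcases Sym2.eq_iff.1 he with ⟨rfl, rfl⟩ | ⟨rfl, rfl⟩
    · exact ⟨hxy, by tauto⟩
    · exact ⟨hxy.symm, by tauto⟩
  · rintro ⟨huv, h⟩
    by_cases hu : u ∈ X
    · exact ⟨u, v, huv, hu, by tauto, rfl⟩
    · exact ⟨v, u, huv.symm, by tauto, hu, Sym2.eq_swap⟩

theorem cutAround_compl (X : Set V) : cutAround G Xᶜ = cutAround G X := by
  ext e
  induction e with | h u v =>
  simp only [mk_mem_cutAround, Set.mem_compl_iff]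
  tauto

/-- In a connected graph, a cut determines its shores. -/
theorem eq_or_eq_compl_of_cutAround_eq (hG : G.Connected) {X Y : Set V}
    (h : cutAround G X = cutAround G Y) : X = Y ∨ X = Yᶜ := by
  -- Whether `X` and `Y` agree at a vertex does not change along an edge, hence is constant on a
  -- connected graph.
  have hadj : ∀ u v, G.Adj u v → ((u ∈ X ↔ u ∈ Y) ↔ (v ∈ X ↔ v ∈ Y)) := by
    intro u v huv
    have h1 : s(u, v) ∈ cutAround G X ↔ s(u, v) ∈ cutAround G Y := by rw [h]
    simp only [mk_mem_cutAround] at h1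
    tauto
  have hwalk : ∀ u v, G.Walk u v → ((u ∈ X ↔ u ∈ Y) ↔ (v ∈ X ↔ v ∈ Y)) := by
    intro u v w
    induction w with
    | nil => rfl
    | cons h _ ih => exact (hadj _ _ h).trans ih
  obtain ⟨r⟩ := hG.nonempty
  by_cases hr : r ∈ X ↔ r ∈ Y
  · left
    ext v
    obtain ⟨w⟩ := hG.preconnected r v
    exact (hwalk r v w).1 hr
  · right
    ext v
    obtain ⟨w⟩ := hG.preconnected r v
    have := hwalk r v w
    simp only [Set.mem_compl_iff]
    tauto

theorem IsKConnected.connected {k : ℕ} (hk : k ≠ 0) (h : IsKConnected k G) : G.Connected := by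
  have := h.2 ∅ (by simpa [pos_iff_ne_zero] using hk)
  rw [Set.compl_empty] at this
  exact (SimpleGraph.induceUnivIso G).connected_iff.1 this

end Cuts

/-! ### Tight cuts have three edges; 3-connected cubic graphs are 3-edge-connected -/

section Tight

variable {V : Type*} {G : SimpleGraph V} {c : V → Bool}

/-- The perfect matching that consists of the edges `v σ(v)` where `v` has colour `true`. -/
def permMatching (c : V → Bool) (σ : Equiv.Perm V) (hσ : ∀ v, G.Adj v (σ v)) : G.Subgraph where
  verts := Set.univ
  Adj u v := (c u = true ∧ σ u = v) ∨ (c v = true ∧ σ v = u)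
  adj_sub := by
    rintro u v (⟨-, rfl⟩ | ⟨-, rfl⟩)
    · exact hσ u
    · exact (hσ v).symm
  edge_vert := fun _ => Set.mem_univ _
  symm := ⟨fun _ _ h => h.symm⟩

theorem permMatching_isPerfectMatching (hcol : ∀ u v, G.Adj u v → c u ≠ c v)
    (σ : Equiv.Perm V) (hσ : ∀ v, G.Adj v (σ v)) :
    (permMatching c σ hσ).IsPerfectMatching := by
  refine ⟨fun v _ => ?_, fun v => Set.mem_univ v⟩
  have h1 := hcol _ _ (hσ v)
  have h2 := hcol _ _ (hσ (σ.symm v))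
  rw [σ.apply_symm_apply] at h2
  cases hv : c v
  · refine ⟨σ.symm v, Or.inr ⟨?_, σ.apply_symm_apply v⟩, ?_⟩
    · rw [hv] at h2; simpa using h2
    · rintro w (⟨h, -⟩ | ⟨-, rfl⟩)
      · simp [hv] at h
      · simp
  · refine ⟨σ v, Or.inl ⟨hv, rfl⟩, ?_⟩
    rintro w (⟨-, rfl⟩ | ⟨h, rfl⟩)
    · rfl
    · have := hcol _ _ (hσ w)
      rw [h, hv] at this
      exact absurd rfl this

variable [Fintype V] [DecidableEq V] [DecidableRel G.Adj]

/-- Each edge of the perfect matching given by `σ` and `c` is named by its end of colour `true`, so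
tightness becomes a count of vertices. -/
theorem card_crossing_of_isTightCut (hcol : ∀ u v, G.Adj u v → c u ≠ c v) {X : Finset V}
    (hX : IsTightCut G (cutAround G X)) (σ : Equiv.Perm V) (hσ : ∀ v, G.Adj v (σ v)) :
    (Finset.univ.filter fun u => c u = true ∧ ¬ (u ∈ X ↔ σ u ∈ X)).card = 1 := by
  rw [← hX.2 _ (permMatching_isPerfectMatching hcol σ hσ), ← Set.ncard_coe_finset]
  rw [← Set.InjOn.ncard_image (f := fun u => s(u, σ u))]
  · congr 1
    ext e
    induction e with | h x y =>
    simp only [Set.mem_image, Finset.coe_filter, Set.mem_ofPred_eq, Finset.mem_univ, true_and,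
      Set.mem_inter_iff, mk_mem_cutAround, SimpleGraph.Subgraph.mem_edgeSet, Finset.mem_coe]
    constructor
    · rintro ⟨u, ⟨hu, hux⟩, he⟩
      rcases Sym2.eq_iff.1 he with ⟨rfl, rfl⟩ | ⟨rfl, rfl⟩
      · exact ⟨⟨hσ u, hux⟩, Or.inl ⟨hu, rfl⟩⟩
      · exact ⟨⟨(hσ u).symm, by tauto⟩, Or.inr ⟨hu, rfl⟩⟩
    · rintro ⟨⟨hxy, hx⟩, ⟨h, rfl⟩ | ⟨h, rfl⟩⟩
      · exact ⟨x, ⟨h, hx⟩, rfl⟩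
      · exact ⟨y, ⟨h, by tauto⟩, Sym2.eq_swap⟩
  · intro u hu v hv huv
    simp only [Finset.coe_filter, Set.mem_ofPred_eq, Finset.mem_univ, true_and] at hu hv
    rcases Sym2.eq_iff.1 huv with ⟨h, -⟩ | ⟨h, -⟩
    · exact h
    · have := hcol _ _ (hσ v)
      rw [← h, hu.1, hv.1] at this
      exact absurd rfl this

/-- The edges `v σ(v)` form two perfect matchings, one for each colour of `v`, so `σ` crosses the
cut twice. Being a bijection, it enters `X` as often as it leaves it, hence leaves once. -/
theorem card_leaving_of_isTightCut (hcol : ∀ u v, G.Adj u v → c u ≠ c v) {X : Finset V}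
    (hX : IsTightCut G (cutAround G X)) (σ : Equiv.Perm V) (hσ : ∀ v, G.Adj v (σ v)) :
    (X.filter fun u => σ u ∉ X).card = 1 := by
  have h1 := card_crossing_of_isTightCut hcol hX σ hσ
  have h2 := card_crossing_of_isTightCut (c := fun v => !c v)
    (fun u v huv => by simpa using hcol u v huv) hX σ hσ
  have h3 : (Finset.univ.filter fun u => u ∈ X ∧ σ u ∉ X).card +
      (Finset.univ.filter fun u => u ∉ X ∧ σ u ∈ X).card = 2 := by
    rw [← Finset.card_union_of_disjoint
      (by rw [Finset.disjoint_left]; intro u; simp +contextual)]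
    change _ = 1 + 1
    nth_rw 1 [← h1]
    rw [← h2, ← Finset.card_union_of_disjoint
      (by rw [Finset.disjoint_left]; intro u; simp +contextual)]
    congr 1
    ext u
    cases h : c u <;> simp [h] <;> tauto
  have h4 : (Finset.univ.filter fun u => σ u ∈ X).card = X.card := by
    rw [← Finset.card_map σ.symm.toEmbedding (s := X)]
    congr 1
    ext u
    simp
  have h5 : (Finset.univ.filter fun u => u ∈ X ∧ σ u ∈ X).card +
      (Finset.univ.filter fun u => u ∉ X ∧ σ u ∈ X).card = X.card := by
    rw [← h4, ← Finset.card_union_of_disjoint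
      (by rw [Finset.disjoint_left]; intro u; simp +contextual)]
    congr 1
    ext u
    simp only [Finset.mem_union, Finset.mem_filter, Finset.mem_univ, true_and]
    tauto
  have h6 : (Finset.univ.filter fun u => u ∈ X ∧ σ u ∈ X).card +
      (Finset.univ.filter fun u => u ∈ X ∧ σ u ∉ X).card = X.card := by
    rw [← Finset.card_union_of_disjoint
      (by rw [Finset.disjoint_left]; intro u; simp +contextual)]
    congr 1
    ext u
    simp only [Finset.mem_union, Finset.mem_filter, Finset.mem_univ, true_and]
    tauto
  have h7 : (X.filter fun u => σ u ∉ X) = Finset.univ.filter fun u => u ∈ X ∧ σ u ∉ X := by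
    ext u; simp
  rw [h7]
  omega

/-- Tight cuts of a cubic bipartite graph have exactly three edges. -/
theorem cutSize_eq_three_of_isTightCut (hc : ∀ v, G.degree v = 3)
    (hcol : ∀ u v, G.Adj u v → c u ≠ c v) {X : Finset V}
    (hX : IsTightCut G (cutAround G X)) : cutSize G X = 3 := by
  set M : Matrix V V ℚ := fun u v => if G.Adj u v then 1 / 3 else 0 with hM
  have hrow : ∀ u, ∑ v, M u v = 1 := fun u => by
    have : (Finset.univ.filter fun v => G.Adj u v).card = 3 := by
      rw [← hc u, ← G.card_neighborFinset_eq_degree, G.neighborFinset_eq_filter]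
    simp [hM, Finset.sum_ite, this]
  have hsymm : ∀ u v, M u v = M v u := fun u v => by simp only [hM, G.adj_comm]
  obtain ⟨w, hw0, hw1, hwM⟩ := exists_eq_sum_perm_of_mem_doublyStochastic
    (M := M) (mem_doublyStochastic_iff_sum.2 ⟨fun u v => by
      simp only [hM]; split_ifs <;> norm_num, hrow, fun v => by
      simp only [hsymm _ v, hrow]⟩)
  have hwM' : ∀ u v, M u v = ∑ σ : Equiv.Perm V, w σ * if σ u = v then 1 else 0 := by
    intro u v
    rw [← hwM, Matrix.sum_apply]
    refine Finset.sum_congr rfl fun σ _ => ?_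
    simp [PEquiv.toMatrix_apply, Equiv.toPEquiv_apply]
  -- If a permutation of non-zero weight left the edges of `G`, it would make a zero entry of `M`
  -- positive.
  have hσ : ∀ σ, w σ ≠ 0 → ∀ v, G.Adj v (σ v) := by
    intro σ hσ v
    by_contra hv
    have h0 : M v (σ v) = 0 := by simp [hM, hv]
    rw [hwM', Finset.sum_eq_zero_iff_of_nonneg
      (fun τ _ => mul_nonneg (hw0 τ) (by split_ifs <;> norm_num))] at h0
    simpa [hσ] using h0 σ (Finset.mem_univ _)
  have h1 : (cutSize G X : ℚ) = 3 * ∑ u ∈ X, ∑ v ∈ Xᶜ, M u v := by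
    simp only [cutSize, edgesBetween, Nat.cast_sum, Finset.mul_sum, hM]
    refine Finset.sum_congr rfl fun u _ => Finset.sum_congr rfl fun v _ => ?_
    split_ifs <;> norm_num
  have h2 : ∑ u ∈ X, ∑ v ∈ Xᶜ, M u v =
      ∑ σ : Equiv.Perm V, w σ * ((X.filter fun u => σ u ∉ X).card : ℚ) := by
    simp only [hwM']
    rw [Finset.sum_congr rfl fun u _ => Finset.sum_comm, Finset.sum_comm]
    refine Finset.sum_congr rfl fun σ _ => ?_
    rw [Finset.card_filter, Nat.cast_sum, Finset.mul_sum]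
    refine Finset.sum_congr rfl fun u _ => ?_
    rw [← Finset.mul_sum, Finset.sum_ite_eq]
    simp
  have h3 : ∑ σ : Equiv.Perm V, w σ * ((X.filter fun u => σ u ∉ X).card : ℚ) = ∑ σ, w σ := by
    refine Finset.sum_congr rfl fun σ _ => ?_
    by_cases h : w σ = 0
    · simp [h]
    · rw [card_leaving_of_isTightCut hcol hX σ (hσ σ h)]; simp
  rw [h2, h3, hw1] at h1
  exact_mod_cast h1

/-- A 3-connected cubic graph is 3-edge-connected. -/
theorem IsKConnected.three_le_cutSize (hG : IsKConnected 3 G) (hc : ∀ v, G.degree v = 3)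
    {X : Finset V} (hX : X.Nonempty) (hXu : X ≠ Finset.univ) : 3 ≤ cutSize G X := by
  by_contra! hlt
  have hdeg : 3 * X.card = edgesBetween G X X + cutSize G X := by
    rw [cutSize, ← edgesBetween_union_right G disjoint_compl_right, Finset.union_compl]
    have : ∀ u, (∑ v, if G.Adj u v then 1 else 0) = 3 := fun u => by
      rw [Finset.sum_boole, ← hc u, ← G.card_neighborFinset_eq_degree, G.neighborFinset_eq_filter]
      simp
    simp [edgesBetween, this, mul_comm]
  have hin : edgesBetween G X X ≤ X.card * (X.card - 1) := by
    unfold edgesBetween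
    refine Finset.sum_le_card_nsmul _ _ _ fun u hu => ?_
    rw [Finset.sum_boole, ← Finset.card_erase_of_mem hu]
    exact Finset.card_le_card fun v hv => by
      simp only [Finset.mem_filter] at hv
      exact Finset.mem_erase.2 ⟨hv.2.ne', hv.1⟩
  have hpos := hX.card_pos
  -- One vertex has three edges leaving it and two vertices have at least four, by `hdeg` and `hin`.
  have h3 : 3 ≤ X.card := by
    by_contra! h
    interval_cases X.card <;> omega
  set T := (X ×ˢ Xᶜ).filter fun e => G.Adj e.1 e.2 with hT
  have hTc : T.card = cutSize G X := by
    rw [hT, Finset.card_filter, Finset.sum_product]; rfl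
  -- The ends in `X` of the cut edges: at most two vertices, whose removal separates the rest of `X`
  -- from the complement.
  set S := T.image Prod.fst with hS
  have hSc : S.card < 3 := (Finset.card_image_le).trans_lt (hTc ▸ hlt)
  have hconn := hG.2 (S : Set V) (by rw [Set.encard_coe_eq_coe_finsetCard]; exact_mod_cast hSc)
  obtain ⟨x, hxX, hxS⟩ : ∃ x ∈ X, x ∉ S := by
    by_contra! h
    have := Finset.card_le_card (fun x hx => h x hx : X ⊆ S)
    omega
  obtain ⟨y, hy⟩ : ∃ y, y ∉ X := by
    by_contra! h
    exact hXu (Finset.eq_univ_iff_forall.2 h)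
  have hyS : y ∉ S := by
    intro h
    simp only [hS, hT, Finset.mem_image, Finset.mem_filter, Finset.mem_product] at h
    obtain ⟨e, he, rfl⟩ := h
    exact hy he.1.1
  have hwalk : ∀ a b : ((S : Set V)ᶜ : Set V), (G.induce (S : Set V)ᶜ).Walk a b →
      (a : V) ∈ X → (b : V) ∈ X := by
    intro a b w
    induction w with
    | nil => exact id
    | @cons a b _ h _ ih =>
      intro ha
      refine ih (by_contra fun hb => a.2 ?_)
      simp only [hS, hT, Finset.coe_image, Set.mem_image, Finset.mem_coe, Finset.mem_filter,
        Finset.mem_product, Finset.mem_compl]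
      exact ⟨(a, b), ⟨⟨ha, hb⟩, h⟩, rfl⟩
  obtain ⟨w⟩ := hconn.preconnected ⟨x, by simpa using hxS⟩ ⟨y, by simpa using hyS⟩
  exact hy (hwalk _ _ w hxX)

end Tight

/-! ### Induction on a laminar family -/

section Merge

variable {V : Type*} [Fintype V] [DecidableEq V]

/-- Identify all vertices of `X` with `x`. -/
def mergeInto (X : Finset V) (x : V) (f : V → V) (v : V) : V := if v ∈ X then f x else f v

variable {X : Finset V} {x : V} {f : V → V}

/-- Since `X` is a union of fibres of `f`, the value `f x` is not taken outside `X`, so the merged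
part counts as one extra value. -/
theorem card_image_mergeInto (hx : x ∈ X) (hX : ∀ u v, f u = f v → (u ∈ X ↔ v ∈ X)) :
    (Finset.univ.image (mergeInto X x f)).card = (Xᶜ.image f).card + 1 := by
  rw [← Finset.card_insert_of_notMem (a := f x)]
  · congr 1
    ext y
    simp only [Finset.mem_image, Finset.mem_univ, true_and, Finset.mem_insert, Finset.mem_compl,
      mergeInto]
    constructor
    · rintro ⟨v, rfl⟩
      split_ifs with h
      · exact Or.inl rfl
      · exact Or.inr ⟨v, h, rfl⟩
    · rintro (rfl | ⟨v, hv, rfl⟩)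
      · exact ⟨x, by simp⟩
      · exact ⟨v, by simp [hv]⟩
  · simp only [Finset.mem_image, Finset.mem_compl, not_exists, not_and]
    intro v hv h
    exact hv ((hX v x h).2 hx)

theorem fiber_mergeInto (hx : x ∈ X) (hX : ∀ u v, f u = f v → (u ∈ X ↔ v ∈ X)) (v : V) :
    (Finset.univ.filter (mergeInto X x f · = mergeInto X x f v)) =
      if v ∈ X then X else Finset.univ.filter (f · = f v) := by
  ext u
  by_cases hv : v ∈ X <;> by_cases hu : u ∈ X <;> simp [hv, hu, mergeInto]
  · intro h
    exact hu ((hX _ _ h).2 hx)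
  · have h1 : f x ≠ f v := fun h => hv ((hX _ _ h).1 hx)
    have h2 : f u ≠ f v := fun h => hv ((hX _ _ h).1 hu)
    simp [h1, h2]

theorem cutSize_fiber_mergeInto {G : SimpleGraph V} [DecidableRel G.Adj] (hx : x ∈ X)
    (hX : ∀ u v, f u = f v → (u ∈ X ↔ v ∈ X)) (hcut : cutSize G X = 3)
    (hf : ∀ v, cutSize G (Finset.univ.filter (f · = f v)) = 3) (v : V) :
    cutSize G (Finset.univ.filter (mergeInto X x f · = mergeInto X x f v)) = 3 := by
  rw [fiber_mergeInto hx hX]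
  split_ifs
  exacts [hcut, hf v]

/-- Bound on a laminar family of cuts with three edges, represented by the shores avoiding `r`, in
the graph obtained by contracting the fibres of `f`. -/
theorem card_laminar_le {G : SimpleGraph V} [DecidableRel G.Adj]
    (hpart : ∀ f : V → V, (∀ v, cutSize G (Finset.univ.filter (f · = f v)) = 3) →
      3 ≤ (Finset.univ.image f).card → 8 ≤ (Finset.univ.image f).card)
    (r : V) (n : ℕ) (S : Finset (Finset V)) (hn : S.card = n) (f : V → V)
    (hf : ∀ v, cutSize G (Finset.univ.filter (f · = f v)) = 3)
    (hf3 : 3 ≤ (Finset.univ.image f).card)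
    (hcut : ∀ X ∈ S, cutSize G X = 3) (hr : ∀ X ∈ S, r ∉ X)
    (hsat : ∀ X ∈ S, ∀ u v, f u = f v → (u ∈ X ↔ v ∈ X))
    (hnt : ∀ X ∈ S, (∃ u ∈ X, ∃ v ∈ X, f u ≠ f v) ∧ ∃ u, u ∉ X ∧ ∃ v, v ∉ X ∧ f u ≠ f v)
    (hlam : ∀ X ∈ S, ∀ Y ∈ S, X ⊆ Y ∨ Y ⊆ X ∨ Disjoint X Y) :
    6 * n + 8 ≤ (Finset.univ.image f).card := by
  induction n generalizing S f with
  | zero => simpa using hpart f hf hf3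
  | succ n ih =>
    -- A smallest shore contains no other member of the family, so every other cut survives the
    -- contraction of `X`.
    obtain ⟨X, hXS, hmin⟩ := Finset.exists_min_image S Finset.card
      (Finset.card_pos.1 (by omega))
    obtain ⟨⟨x, hx, x', hx', hxx'⟩, y, hy, y', hy', hyy'⟩ := hnt X hXS
    have hsX := hsat X hXS
    have hsXc : ∀ u v, f u = f v → (u ∈ Xᶜ ↔ v ∈ Xᶜ) := fun u v h => by
      simp [hsX u v h]
    have h1 := card_image_mergeInto hx hsX
    have h2 := card_image_mergeInto (Finset.mem_compl.2 hy) hsXc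
    rw [compl_compl] at h2
    have hX2 : 1 < (X.image f).card := Finset.one_lt_card.2
      ⟨_, Finset.mem_image_of_mem f hx, _, Finset.mem_image_of_mem f hx', hxx'⟩
    have hXc2 : 1 < (Xᶜ.image f).card := Finset.one_lt_card.2
      ⟨_, Finset.mem_image_of_mem f (Finset.mem_compl.2 hy), _,
        Finset.mem_image_of_mem f (Finset.mem_compl.2 hy'), hyy'⟩
    -- Contracting the complement of `X` leaves at least eight parts, so `X` itself contains at
    -- least seven fibres.
    have h3 := hpart _ (cutSize_fiber_mergeInto (Finset.mem_compl.2 hy) hsXc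
      (by rw [cutSize_compl, hcut X hXS]) hf) (by omega)
    have hsum : (Finset.univ.image f).card = (X.image f).card + (Xᶜ.image f).card := by
      rw [← Finset.card_union_of_disjoint, ← Finset.image_union, Finset.union_compl]
      rw [Finset.disjoint_left]
      intro z hz hz'
      obtain ⟨u, hu, rfl⟩ := Finset.mem_image.1 hz
      obtain ⟨v, hv, huv⟩ := Finset.mem_image.1 hz'
      exact (Finset.mem_compl.1 hv) ((hsX v u huv).2 hu)
    have hcase : ∀ D ∈ S.erase X, (X ⊆ D ∧ ∃ d ∈ D, d ∉ X) ∨ Disjoint X D := by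
      intro D hD
      obtain ⟨hDX, hDS⟩ := Finset.mem_erase.1 hD
      have hnot : ¬ D ⊆ X := fun h => hDX (Finset.eq_of_subset_of_card_le h (hmin D hDS))
      rcases hlam X hXS D hDS with h | h | h
      · exact Or.inl ⟨h, by simpa [Finset.subset_iff] using hnot⟩
      · exact absurd h hnot
      · exact Or.inr h
    have hin : ∀ v ∈ X, mergeInto X x f v = f x := fun v hv => by simp [mergeInto, hv]
    have hout : ∀ v, v ∉ X → mergeInto X x f v = f v := fun v hv => by simp [mergeInto, hv]
    have hio : ∀ v, v ∉ X → f x ≠ f v := fun v hv h => hv ((hsX _ _ h).1 hx)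
    have key := ih (S.erase X) (by rw [Finset.card_erase_of_mem hXS, hn]; rfl) (mergeInto X x f)
      (cutSize_fiber_mergeInto hx hsX (hcut X hXS) hf) (by omega)
      (fun D hD => hcut D (Finset.mem_of_mem_erase hD))
      (fun D hD => hr D (Finset.mem_of_mem_erase hD))
      (fun D hD u v huv => by
        have hDS := Finset.mem_of_mem_erase hD
        by_cases hu : u ∈ X <;> by_cases hv : v ∈ X
        · rcases hcase D hD with ⟨h, -⟩ | h
          · simp [h hu, h hv]
          · simp [Finset.disjoint_left.1 h hu, Finset.disjoint_left.1 h hv]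
        · rw [hin u hu, hout v hv] at huv
          exact absurd huv (hio v hv)
        · rw [hout u hu, hin v hv] at huv
          exact absurd huv.symm (hio u hu)
        · rw [hout u hu, hout v hv] at huv
          exact hsat D hDS u v huv)
      (fun D hD => by
        have hDS := Finset.mem_of_mem_erase hD
        obtain ⟨⟨a, ha, a', ha', haa⟩, b, hb, b', hb', hbb⟩ := hnt D hDS
        rcases hcase D hD with ⟨h, d, hd, hdX⟩ | h
        · refine ⟨⟨x, h hx, d, hd, ?_⟩, b, hb, b', hb', ?_⟩
          · rw [hin x hx, hout d hdX]
            exact hio d hdX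
          · rwa [hout b (fun h' => hb (h h')), hout b' (fun h' => hb' (h h'))]
        -- Here the contracted `X` may be all that distinguishes the outside of `D` from one part;
        -- the root `r`, which lies in no shore, supplies a second part there.
        · have h' := Finset.disjoint_right.1 h
          refine ⟨⟨a, ha, a', ha', ?_⟩, x, Finset.disjoint_left.1 h hx, r, hr D hDS, ?_⟩
          · rwa [hout a (h' ha), hout a' (h' ha')]
          · rw [hin x hx, hout r (hr X hXS)]
            exact hio r (hr X hXS))
      (fun D hD E hE => hlam D (Finset.mem_of_mem_erase hD) E (Finset.mem_of_mem_erase hE))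
    -- With `a` fibres inside `X` and `b` outside, `a + 1 ≥ 8` and `b + 1 ≥ 6 n + 8` give `a + b ≥ 6
    -- (n + 1) + 8`.
    omega

end Merge

/-! ### The upper bound -/

/-- A family of non-trivial, pairwise laminar tight cuts of a graph in the class `𝔅` on `n` vertices
has at most `(n - 8) / 6` members. -/
theorem IsLaminarTightFamily.six_mul_ncard_add_eight_le {V : Type*} {G : SimpleGraph V}
    (hG : InBarnetteClass G) {F : Set (Set (Sym2 V))} (hF : IsLaminarTightFamily G F) :
    6 * F.ncard + 8 ≤ Nat.card V := by
  classical
  have := hG.finite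
  have := Fintype.ofFinite V
  have hc : ∀ v, G.degree v = 3 := fun v => by
    rw [← hG.cubic v, ← SimpleGraph.card_neighborSet_eq_degree, Set.ncard_eq_toFinset_card',
      Set.toFinset_card]
  obtain ⟨χ⟩ := hG.bipartite
  set c : V → Bool := fun v => decide (χ v = 0) with hcdef
  have hcol : ∀ u v, G.Adj u v → c u ≠ c v := by
    intro u v huv
    have := χ.valid huv
    simp only [hcdef, ne_eq, decide_eq_decide]
    omega
  have hconn := hG.threeConnected.connected (by decide)
  have h3 : ∀ X : Finset V, X.Nonempty → X ≠ Finset.univ → 3 ≤ cutSize G X :=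
    fun X => hG.threeConnected.three_le_cutSize hc
  have hpart : ∀ f : V → V, (∀ v, cutSize G (Finset.univ.filter (f · = f v)) = 3) →
      3 ≤ (Finset.univ.image f).card → 8 ≤ (Finset.univ.image f).card := by
    intro f hf hcard
    rw [← Fintype.card_coe] at hcard ⊢
    refine eight_le_card_parts hG.planar hc c hcol h3
      (fun v => (⟨f v, Finset.mem_image_of_mem f (Finset.mem_univ v)⟩ : Finset.univ.image f))
      ?_ ?_ hcard
    · rintro ⟨y, hy⟩
      obtain ⟨v, -, rfl⟩ := Finset.mem_image.1 hy
      exact ⟨v, rfl⟩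
    · rintro ⟨y, hy⟩
      obtain ⟨v, -, rfl⟩ := Finset.mem_image.1 hy
      simpa using hf v
  obtain ⟨r⟩ := hconn.nonempty
  -- Each cut is represented by its shore avoiding a fixed root `r`.
  set S : Finset (Finset V) :=
    Finset.univ.filter fun X => r ∉ X ∧ cutAround G (X : Set V) ∈ F with hS
  have hFS : F ⊆ (fun X : Finset V => cutAround G (X : Set V)) '' S := by
    intro C hC
    obtain ⟨⟨⟨X, rfl⟩, -⟩, -⟩ := hF.1 C hC
    by_cases hr : r ∈ X
    · refine ⟨Xᶜ.toFinset, ?_, ?_⟩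
      · simpa [hS, hr, cutAround_compl] using hC
      · simp [cutAround_compl]
    · exact ⟨X.toFinset, by simpa [hS, hr] using hC, by simp⟩
  have hle : F.ncard ≤ S.card := by
    rw [← Set.ncard_coe_finset]
    exact (Set.ncard_le_ncard hFS).trans (Set.ncard_image_le S.finite_toSet)
  have hmem : ∀ X ∈ S, r ∉ X ∧ cutAround G (X : Set V) ∈ F := fun X hX => by
    simpa [hS] using hX
  have hsing : ∀ v, cutSize G {v} = 3 := by
    intro v
    rw [← hc v, ← G.card_neighborFinset_eq_degree, G.neighborFinset_eq_filter,
      Finset.card_filter, cutSize, edgesBetween, Finset.sum_singleton, Finset.compl_singleton,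
      ← Finset.sum_erase_add _ _ (Finset.mem_univ v), if_neg (G.irrefl), add_zero]
  have hV : 3 ≤ Fintype.card V := by
    have := hG.threeConnected.1
    rw [ENat.card_eq_coe_fintype_card] at this
    have : 3 < Fintype.card V := by exact_mod_cast this
    omega
  have main := card_laminar_le hpart r S.card S rfl id
    (fun v => by
      have h : (Finset.univ.filter (id · = id v)) = {v} := by ext; simp
      rw [h, hsing]) (by simpa using hV)
    (fun X hX => cutSize_eq_three_of_isTightCut hc hcol (hF.1 _ (hmem X hX).2).1)
    (fun X hX => (hmem X hX).1) (by rintro X - u v rfl; rfl)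
    (fun X hX => by
      have : (X : Set V).Nontrivial ∧ (X : Set V)ᶜ.Nontrivial := by
        obtain ⟨Y, hY, h1, h2⟩ := (hF.1 _ (hmem X hX).2).2
        rcases eq_or_eq_compl_of_cutAround_eq hconn hY with h | h
        · rw [h]; exact ⟨h1, h2⟩
        · rw [h, compl_compl]; exact ⟨h2, h1⟩
      obtain ⟨⟨a, ha, b, hb, hab⟩, a', ha', b', hb', hab'⟩ := this
      exact ⟨⟨a, ha, b, hb, hab⟩, a', ha', b', hb', hab'⟩)
    (fun X hX Y hY => by
      by_cases hXY : X = Y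
      · exact Or.inl hXY.subset
      have hrX := (hmem X hX).1
      have hrY := (hmem Y hY).1
      have hne : cutAround G (X : Set V) ≠ cutAround G Y := by
        intro h
        rcases eq_or_eq_compl_of_cutAround_eq hconn h with h | h
        · exact hXY (Finset.coe_injective h)
        · have : r ∈ (X : Set V) := by rw [h]; simpa using hrY
          exact hrX (by simpa using this)
      obtain ⟨X', Y', hX', hY', hXY'⟩ := hF.2 (hmem X hX).2 (hmem Y hY).2 hne
      rw [← Finset.coe_subset, ← Finset.coe_subset, ← Finset.disjoint_coe,
        Set.disjoint_left, Set.subset_def, Set.subset_def]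
      rw [← Finset.mem_coe] at hrX hrY
      -- The shores witnessing laminarity may be the complements of the chosen ones. Neither of the
      -- chosen shores contains `r`, so they cannot cover all vertices, and only nesting and
      -- disjointness remain.
      rcases eq_or_eq_compl_of_cutAround_eq hconn hX'.symm with rfl | rfl <;>
      rcases eq_or_eq_compl_of_cutAround_eq hconn hY'.symm with rfl | rfl <;>
      rcases hXY' with h | h
      · exact Or.inl fun v => @h v
      · exact Or.inr (Or.inl fun v => @h v)
      · exact Or.inr (Or.inr fun v => @h v)
      · exact absurd (@h r hrY) hrX
      · exact absurd (@h r hrX) hrY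
      · exact Or.inr (Or.inr fun v hX hY => @h v hY hX)
      · exact Or.inr (Or.inl fun v hv => Set.compl_subset_compl.1 h hv)
      · exact Or.inl fun v hv => Set.compl_subset_compl.1 h hv)
  rw [Nat.card_eq_fintype_card]
  simp only [Finset.image_id, Finset.card_univ] at main
  omega

/-! ### Invariance under isomorphism -/

section Iso

variable {V W : Type*} {G : SimpleGraph V} {H : SimpleGraph W}

theorem IsPlanar.of_iso (e : G ≃g H) (h : IsPlanar H) : IsPlanar G := by
  obtain ⟨pt, arc, hinj, harc, hpt, hmeet⟩ := h
  have hmem : ∀ d ∈ G.edgeSet, d.map e ∈ H.edgeSet := by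
    intro d hd
    induction d with | h u v =>
    exact e.map_adj_iff.2 hd
  have hmap : ∀ (w : V) (d : Sym2 V), e w ∈ d.map e ↔ w ∈ d := by
    intro w d
    simp [Sym2.mem_map]
  refine ⟨fun v => pt (e v), fun d => arc (d.map e), hinj.comp e.injective,
    fun u v huv => harc (e u) (e v) (e.map_adj_iff.2 huv),
    fun d hd w hw => (hmap w d).1 (hpt _ (hmem d hd) _ hw), ?_⟩
  intro d hd f hf hdf x hx
  obtain ⟨w, ⟨hw1, hw2⟩, rfl⟩ := hmeet _ (hmem d hd) _ (hmem f hf)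
    (fun h => hdf (Sym2.map.injective e.injective h)) hx
  obtain ⟨v, rfl⟩ := e.surjective w
  exact ⟨v, ⟨(hmap v d).1 hw1, (hmap v f).1 hw2⟩, rfl⟩

theorem IsKConnected.of_iso {k : ℕ} (e : G ≃g H) (h : IsKConnected k H) : IsKConnected k G := by
  refine ⟨by rw [ENat.card_congr e.toEquiv]; exact h.1, fun S hS => ?_⟩
  have h2 := h.2 (e '' S) (by rwa [e.injective.encard_image])
  have : e '' Sᶜ = (e '' S)ᶜ := Set.image_compl_eq e.bijective
  rw [← this] at h2
  exact ((e.induce (e.injective.injOn.bijOn_image (s := Sᶜ))).connected_iff).2 h2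

theorem InBarnetteClass.of_iso (e : G ≃g H) (h : InBarnetteClass H) : InBarnetteClass G where
  finite := have := h.finite; Finite.of_equiv W e.symm.toEquiv
  cubic v := by
    rw [← h.cubic (e v)]
    exact Nat.card_congr (e.mapNeighborSet v)
  threeConnected := h.threeConnected.of_iso e
  planar := h.planar.of_iso e
  bipartite := h.bipartite.of_hom e.toHom

end Iso

/-! ### Straight-line drawings with integral coordinates -/

section StraightLine

/-- Twice the signed area of the triangle `abc`. -/
def orient {R : Type*} [CommRing R] (a b c : R × R) : R :=
  (b.1 - a.1) * (c.2 - a.2) - (b.2 - a.2) * (c.1 - a.1)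

theorem mem_segment_iff_exists {a b x : ℝ × ℝ} : x ∈ segment ℝ a b ↔
    ∃ t : ℝ, 0 ≤ t ∧ t ≤ 1 ∧ x = (a.1 + t * (b.1 - a.1), a.2 + t * (b.2 - a.2)) := by
  rw [segment_eq_image']
  constructor
  · rintro ⟨t, ht, rfl⟩
    exact ⟨t, ht.1, ht.2, by ext <;> simp⟩
  · rintro ⟨t, h0, h1, rfl⟩
    exact ⟨t, ⟨h0, h1⟩, by ext <;> simp⟩

theorem orient_eq_zero_of_mem_segment {a b x : ℝ × ℝ} (h : x ∈ segment ℝ a b) :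
    orient a b x = 0 := by
  obtain ⟨t, -, -, rfl⟩ := mem_segment_iff_exists.1 h
  simp only [orient]
  ring

/-- Along the segment from `a` to `c` the orientation relative to `ab` is `t * orient a b c`, which
vanishes only at `t = 0`. -/
theorem eq_of_mem_segments {a b c x : ℝ × ℝ} (h : orient a b c ≠ 0) (hb : x ∈ segment ℝ a b)
    (hc : x ∈ segment ℝ a c) : x = a := by
  have h0 := orient_eq_zero_of_mem_segment hb
  obtain ⟨t, -, -, rfl⟩ := mem_segment_iff_exists.1 hc
  have : t * orient a b c = 0 := by
    rw [← h0]; simp only [orient]; ring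
  obtain rfl := (mul_eq_zero.1 this).resolve_right h
  ext <;> simp

/-- The ends `c` and `d` lie strictly on the same side of the line `ab`, hence so does the whole
segment between them. -/
theorem not_mem_segments {a b c d x : ℝ × ℝ} (h : 0 < orient a b c * orient a b d)
    (hb : x ∈ segment ℝ a b) (hc : x ∈ segment ℝ c d) : False := by
  have h0 := orient_eq_zero_of_mem_segment hb
  obtain ⟨t, ht0, ht1, rfl⟩ := mem_segment_iff_exists.1 hc
  have h1 : (1 - t) * orient a b c + t * orient a b d = 0 := by
    rw [← h0]; simp only [orient]; ring
  rcases ht0.eq_or_lt with rfl | ht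
  · simp only [sub_zero, one_mul, zero_mul, add_zero] at h1
    simp [h1] at h
  · rcases mul_pos_iff.1 h with ⟨hc', hd'⟩ | ⟨hc', hd'⟩
    · linarith [mul_pos ht hd', mul_nonneg (sub_nonneg.2 ht1) hc'.le]
    · linarith [mul_pos ht (neg_pos.2 hd'), mul_nonneg (sub_nonneg.2 ht1) (neg_pos.2 hc').le]

/-- A sufficient condition, decidable for finite graphs, for integral points to be the vertices of
a drawing with straight edges. -/
theorem isPlanar_of_points {V : Type*} {G : SimpleGraph V} (p : V → ℤ × ℤ)
    (hinj : p.Injective)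
    (hgen : ∀ a b, G.Adj a b → ∀ c, c ≠ a → c ≠ b → orient (p a) (p b) (p c) ≠ 0)
    (hsep : ∀ a b, G.Adj a b → ∀ c d, G.Adj c d → a ≠ c → a ≠ d → b ≠ c → b ≠ d →
      0 < orient (p a) (p b) (p c) * orient (p a) (p b) (p d) ∨
      0 < orient (p c) (p d) (p a) * orient (p c) (p d) (p b)) : IsPlanar G := by
  set pt : V → ℝ × ℝ := fun v => ((p v).1, (p v).2) with hptdef
  have hor : ∀ a b c, orient (pt a) (pt b) (pt c) = (orient (p a) (p b) (p c) : ℤ) := by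
    intro a b c
    simp [orient, hptdef]
  have hgen' : ∀ a b, G.Adj a b → ∀ c, c ≠ a → c ≠ b → orient (pt a) (pt b) (pt c) ≠ 0 := by
    intro a b hab c hca hcb
    rw [hor]
    exact_mod_cast hgen a b hab c hca hcb
  have hpt : pt.Injective := by
    intro u v h
    simp only [hptdef, Prod.mk.injEq, Int.cast_inj] at h
    exact hinj (Prod.ext h.1 h.2)
  refine ⟨pt, Sym2.lift ⟨fun u v => segment ℝ (pt u) (pt v), fun u v => segment_symm _ _ _⟩,
    hpt, ?_, ?_, ?_⟩
  · intro u v huv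
    refine ⟨Path.segment (pt u) (pt v), ?_, Path.range_segment _ _⟩
    intro s t hst
    have hne : pt u ≠ pt v := hpt.ne huv.ne
    exact Subtype.ext (AffineMap.lineMap_injective ℝ hne hst)
  · intro e he w hw
    induction e with | h u v =>
    by_contra h
    simp only [Sym2.mem_iff, not_or] at h
    exact hgen' u v he w h.1 h.2 (orient_eq_zero_of_mem_segment hw)
  · intro e he f hf hef x hx
    induction e with | h a b =>
    induction f with | h c d =>
    obtain ⟨h1, h2⟩ := hx
    simp only [Sym2.lift_mk] at h1 h2
    rw [SimpleGraph.mem_edgeSet] at he hf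
    have shared : ∀ a b d, G.Adj a b → G.Adj a d → b ≠ d → x ∈ segment ℝ (pt a) (pt b) →
        x ∈ segment ℝ (pt a) (pt d) → x = pt a := fun a b d hab had hbd =>
      eq_of_mem_segments (hgen' a b hab d had.ne' hbd.symm)
    by_cases hac : a = c
    · subst hac
      exact ⟨a, by simp, (shared a b d he hf (by rintro rfl; exact hef rfl) h1 h2).symm⟩
    by_cases had : a = d
    · subst had
      rw [segment_symm] at h2
      exact ⟨a, by simp, (shared a b c he hf.symm
        (by rintro rfl; exact hef Sym2.eq_swap) h1 h2).symm⟩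
    by_cases hbc : b = c
    · subst hbc
      rw [segment_symm] at h1
      exact ⟨b, by simp, (shared b a d he.symm hf had h1 h2).symm⟩
    by_cases hbd : b = d
    · subst hbd
      rw [segment_symm] at h1 h2
      exact ⟨b, by simp, (shared b a c he.symm hf.symm hac h1 h2).symm⟩
    exfalso
    rcases hsep a b he c d hf hac had hbc hbd with h | h
    · exact not_mem_segments (by rw [hor, hor]; exact_mod_cast h) h1 h2
    · exact not_mem_segments (by rw [hor, hor]; exact_mod_cast h) h2 h1

end StraightLine

/-! ### Computing connectivity -/

section Connectivity

/-- Add to the set of vertices encoded by the bits of `m` all vertices `v` in `l` that satisfy `ok`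
and have a neighbour in this set. -/
def growOnce {n : ℕ} (nbrs : Fin n → List (Fin n)) (ok : Fin n → Bool) (m : ℕ) : ℕ :=
  (List.finRange n).foldl
    (fun acc v => if ok v && (nbrs v).any (fun u => m.testBit u) then acc ||| 2 ^ v.1 else acc) m

/-- Only soundness is needed: the computed set never contains too much. That it contains enough is
verified by evaluation. -/
theorem testBit_growOnce {n : ℕ} {nbrs : Fin n → List (Fin n)} {ok : Fin n → Bool} {m : ℕ}
    {v : Fin n} (h : (growOnce nbrs ok m).testBit v) :
    m.testBit v ∨ ok v ∧ ∃ u ∈ nbrs v, m.testBit u := by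
  have key : ∀ (l : List (Fin n)) (p : Fin n → Bool) (acc : ℕ),
      (l.foldl (fun acc v => if p v then acc ||| 2 ^ v.1 else acc) acc).testBit v →
      acc.testBit v ∨ p v := by
    intro l p
    induction l with
    | nil => exact fun acc h => Or.inl h
    | cons a l ih =>
      intro acc h
      rcases ih _ h with h | h
      · by_cases hp : p a
        · simp only [hp, if_true, Nat.testBit_or, Bool.or_eq_true, Nat.testBit_two_pow,
            decide_eq_true_eq] at h
          rcases h with h | h
          · exact Or.inl h
          · exact Or.inr (Fin.ext h ▸ hp)
        · exact Or.inl (by simpa [hp] using h)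
      · exact Or.inr h
  rcases key _ _ _ h with h | h
  · exact Or.inl h
  · right
    simpa using h

/-- A computable criterion for connectivity of an induced subgraph. -/
theorem connected_of_grow {n : ℕ} {G : SimpleGraph (Fin n)} (nbrs : Fin n → List (Fin n))
    (hG : ∀ u v, u ∈ nbrs v → G.Adj v u) (ok : Fin n → Bool) (r : Fin n) (hr : ok r) (k : ℕ)
    (hk : ∀ v, ok v → ((growOnce nbrs ok)^[k] (2 ^ r.1)).testBit v) :
    (G.induce {v | ok v}).Connected := by
  have key : ∀ k v, ((growOnce nbrs ok)^[k] (2 ^ r.1)).testBit v.1 →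
      ∃ hv : ok v, (G.induce {v | ok v}).Reachable ⟨r, hr⟩ ⟨v, hv⟩ := by
    intro k
    induction k with
    | zero =>
      intro v hv
      simp only [Function.iterate_zero, id_eq, Nat.testBit_two_pow, decide_eq_true_eq] at hv
      obtain rfl := Fin.ext hv
      exact ⟨hr, SimpleGraph.Reachable.refl _⟩
    | succ k ih =>
      intro v hv
      rw [Function.iterate_succ_apply'] at hv
      rcases testBit_growOnce hv with h | ⟨hv, u, hu, h⟩
      · exact ih v h
      · obtain ⟨hu', hreach⟩ := ih u h
        exact ⟨hv, hreach.trans (SimpleGraph.Adj.reachable (G := G.induce {v | ok v})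
          (u := ⟨u, hu'⟩) (v := ⟨v, hv⟩) (hG u v hu).symm)⟩
  have : Nonempty {v | ok v} := ⟨⟨r, hr⟩⟩
  refine ⟨fun x y => ?_⟩
  obtain ⟨_, hx⟩ := key k x (hk x x.2)
  obtain ⟨_, hy⟩ := key k y (hk y y.2)
  exact hx.symm.trans hy

end Connectivity

/-! ### An explicit cube-expansion of the cube lies in the class -/

section CubeExpansion

/-- Neighbours in a copy of the cube-expansion of the cube. The numbers `0, …, 6` stand for the
binary representations of `1, …, 7`, followed by the centre, the inner and the outer vertices. -/
def expandedCubeNbrs : Fin 14 → List (Fin 14) :=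
  ![[2, 4, 11], [2, 5, 12], [0, 1, 6], [4, 5, 13], [0, 3, 6], [1, 3, 6], [2, 4, 5], [8, 9, 10],
    [7, 12, 13], [7, 11, 13], [7, 11, 12], [0, 9, 10], [1, 8, 10], [3, 8, 9]]

/-- A copy of the cube-expansion of the cube. -/
def expandedCube : SimpleGraph (Fin 14) where
  Adj u v := v ∈ expandedCubeNbrs u
  symm := ⟨by decide⟩
  loopless := ⟨by decide⟩

instance : DecidableRel expandedCube.Adj := fun u v =>
  inferInstanceAs (Decidable (v ∈ expandedCubeNbrs u))

/-- The vertices of a straight-line drawing of `expandedCube`. -/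
def expandedCubePoints : Fin 14 → ℤ × ℤ :=
  ![(5, 0), (-3, 4), (2, 4), (1, 2), (2, 2), (0, 3), (1, 3), (-1, -3), (-2, -1), (0, -3),
    (-2, -4), (3, -4), (-5, 0), (-1, -1)]

theorem isPlanar_expandedCube : IsPlanar expandedCube := by
  refine isPlanar_of_points expandedCubePoints (by unfold Function.Injective; decide +kernel) ?_ ?_
  · unfold orient; decide +kernel
  · unfold orient; decide +kernel

theorem isKConnected_expandedCube : IsKConnected 3 expandedCube := by
  have key : ∀ ok : Fin 14 → Bool, (∃ r : Fin 14, ok r ∧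
      ∀ v, ok v → ((growOnce expandedCubeNbrs ok)^[7] (2 ^ r.1)).testBit v) →
      (expandedCube.induce {v | ok v}).Connected := fun ok ⟨r, hr, h⟩ =>
    connected_of_grow expandedCubeNbrs (fun u v h => h) ok r hr 7 h
  -- The case `a = b` covers the removal of a single vertex. Seven rounds of growth suffice for
  -- every pair.
  have k2 : ∀ a b : Fin 14, ∃ r : Fin 14, (r ≠ a ∧ r ≠ b) ∧ ∀ v, (v ≠ a ∧ v ≠ b) →
      ((growOnce expandedCubeNbrs (fun v => decide (v ≠ a ∧ v ≠ b)))^[7] (2 ^ r.1)).testBit v := by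
    decide +kernel
  have k0 : ∃ r : Fin 14, ∀ v : Fin 14,
      ((growOnce expandedCubeNbrs (fun _ => true))^[7] (2 ^ r.1)).testBit v := by
    decide +kernel
  refine ⟨by simp; norm_num, fun S hS => ?_⟩
  have h2 : ∀ a b : Fin 14, S = {a, b} → (expandedCube.induce Sᶜ).Connected := by
    intro a b hS
    obtain ⟨r, hr, h⟩ := k2 a b
    have := key (fun v => decide (v ≠ a ∧ v ≠ b)) ⟨r, by simpa using hr, by simpa using h⟩
    rwa [show Sᶜ = {v | decide (v ≠ a ∧ v ≠ b) = true} by rw [hS]; ext; simp]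
  have hfin := S.toFinite
  have hS' : S.ncard < 3 := by
    rw [← hfin.cast_ncard_eq] at hS
    exact_mod_cast hS
  interval_cases h : S.ncard
  · rw [Set.ncard_eq_zero] at h
    obtain ⟨r, hr⟩ := k0
    have := key (fun _ => true) ⟨r, rfl, fun v _ => hr v⟩
    rwa [show Sᶜ = {v : Fin 14 | (fun _ => true) v = true} by rw [h]; ext; simp]
  · obtain ⟨a, rfl⟩ := Set.ncard_eq_one.1 h
    exact h2 a a (by simp)
  · obtain ⟨a, b, -, hab⟩ := Set.ncard_eq_two.1 h
    exact h2 a b hab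

theorem inBarnetteClass_expandedCube : InBarnetteClass expandedCube where
  finite := inferInstance
  cubic v := by
    rw [Set.ncard_eq_toFinset_card']
    revert v
    decide
  threeConnected := isKConnected_expandedCube
  planar := isPlanar_expandedCube
  bipartite := ⟨SimpleGraph.Coloring.mk ![0, 0, 1, 0, 1, 1, 0, 1, 0, 0, 0, 1, 1, 1] (by decide)⟩

end CubeExpansion

/-! ### All cube-expansions of the cube are isomorphic -/

section CubeExpansion

/-- The vertex of `expandedCube` that stands for a vertex other than `0` of the cube. -/
def cubeCode (y : Fin 3 → Bool) : Fin 14 :=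
  -- Adding 13 in `Fin 14` subtracts 1 from the binary value. The zero vertex would land on 13, the
  -- code of an outer vertex, so it has to be excluded later.
  (if y 0 then 1 else 0) + (if y 1 then 2 else 0) + (if y 2 then 4 else 0) + 13

/-- The vertex of `expandedCube` that stands for a vertex of the gadget. -/
def gadgetCode : Gadget → Fin 14
  | .centre => 7
  | .inner i => i.castLE (by norm_num) + 8
  | .outer i => i.castLE (by norm_num) + 11

theorem cubeCode_adj (x y : Fin 3 → Bool) (hx : x ≠ fun _ => false) (hy : y ≠ fun _ => false) :
    expandedCube.Adj (cubeCode x) (cubeCode y) ↔ cube.Adj x y := by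
  have : ∀ x y : Fin 3 → Bool, x ≠ (fun _ => false) → y ≠ (fun _ => false) →
      (expandedCube.Adj (cubeCode x) (cubeCode y) ↔ ∃ i, x i ≠ y i ∧ ∀ j, x j ≠ y j → j = i) := by
    decide +kernel
  exact this x y hx hy

theorem cubeCode_inj (x y : Fin 3 → Bool) (h : cubeCode x = cubeCode y) : x = y := by
  revert x y
  decide +kernel

theorem cubeCode_adj_outer (x : Fin 3 → Bool) (hx : x ≠ fun _ => false) (i : Fin 3) :
    expandedCube.Adj (cubeCode x) (gadgetCode (.outer i)) ↔ x = fun k => decide (k = i) := by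
  revert x i
  decide +kernel

theorem cubeCode_not_adj (x : Fin 3 → Bool) (hx : x ≠ fun _ => false) :
    ¬ expandedCube.Adj (cubeCode x) (gadgetCode .centre) ∧
      ∀ i, ¬ expandedCube.Adj (cubeCode x) (gadgetCode (.inner i)) := by
  revert x
  decide +kernel

theorem cubeCode_ne_gadgetCode (x : Fin 3 → Bool) (hx : x ≠ fun _ => false) (g : Gadget) :
    cubeCode x ≠ gadgetCode g := by
  have : ∀ x : Fin 3 → Bool, x ≠ (fun _ => false) → cubeCode x ≠ gadgetCode .centre ∧
      (∀ i, cubeCode x ≠ gadgetCode (.inner i)) ∧ ∀ i, cubeCode x ≠ gadgetCode (.outer i) := by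
    decide +kernel
  obtain ⟨h1, h2, h3⟩ := this x hx
  cases g
  exacts [h1, h2 _, h3 _]

theorem gadgetCode_inj : gadgetCode.Injective := by
  rintro (_ | i | i) (_ | j | j) h <;> simp only [gadgetCode] at h <;>
    first | rfl | (exfalso; revert h; revert i; decide) | (exfalso; revert h; revert j; decide) |
      (exfalso; revert h; revert i j; decide) | (congr 1; revert h; revert i j; decide)

theorem gadgetCode_adj (g h : Gadget) :
    expandedCube.Adj (gadgetCode g) (gadgetCode h) ↔ g.Adj h := by
  rcases g with _ | i | i <;> rcases h with _ | j | j <;> simp only [Gadget.Adj] <;>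
    first | decide | (revert i j; decide) | (revert i; decide) | (revert j; decide)

/-- The seven vertices of the gadget. -/
def gadgetEquiv : Gadget ≃ Option (Fin 3 ⊕ Fin 3) where
  toFun
    | .centre => none
    | .inner i => some (.inl i)
    | .outer i => some (.inr i)
  invFun
    | none => .centre
    | some (.inl i) => .inner i
    | some (.inr i) => .outer i
  left_inv := by rintro (_ | _ | _) <;> rfl
  right_inv := by rintro (_ | _ | _) <;> rfl

instance : Finite Gadget := Finite.of_equiv _ gadgetEquiv.symm

theorem card_cubeExpansion (v : Fin 3 → Bool) :
    Nat.card ({w : Fin 3 → Bool // w ≠ v} ⊕ Gadget) = 14 := by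
  rw [Nat.card_sum, Nat.card_congr gadgetEquiv]
  simp [Fintype.card_subtype_compl]

/-- All cube-expansions of the cube are isomorphic to `expandedCube`. -/
theorem nonempty_iso_expandedCube (v : Fin 3 → Bool) (σ : cube.neighborSet v ≃ Fin 3) :
    Nonempty (cubeExpansion cube v σ ≃g expandedCube) := by
  have hσ : ∀ j, ∃ i, v i ≠ (σ.symm j : Fin 3 → Bool) i ∧
      ∀ k, v k ≠ (σ.symm j : Fin 3 → Bool) k → k = i := fun j => (σ.symm j).2
  -- `d j` is the coordinate in which the neighbour numbered `j` differs from `v`.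
  choose d hd hd' using hσ
  have hdinj : d.Injective := by
    intro i j hij
    apply σ.symm.injective
    apply Subtype.ext
    funext k
    have h1 := hd i
    have h2 := hd j
    have h3 := hd' i k
    have h4 := hd' j k
    by_cases hk : k = d i
    · have hk' : k = d j := hk.trans hij
      rw [← hk] at h1
      rw [← hk'] at h2
      revert h1 h2
      cases v k <;> cases (σ.symm i : Fin 3 → Bool) k <;>
        cases (σ.symm j : Fin 3 → Bool) k <;> simp
    · have h5 := not_not.1 (mt h3 hk)
      have h6 := not_not.1 (mt h4 (hij ▸ hk))
      rw [← h5, h6]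
  have hdbij : d.Bijective := Finite.injective_iff_bijective.1 hdinj
  set e := Equiv.ofBijective d hdbij with he
  -- This automorphism of the cube translates by `v` and permutes coordinates by `d`, so that `v`
  -- goes to the zero vertex and its neighbour numbered `j` to the `j`-th unit vector.
  set τ : (Fin 3 → Bool) → Fin 3 → Bool := fun w j => xor (w (d j)) (v (d j)) with hτ
  have hτne : ∀ w w' j, τ w j ≠ τ w' j ↔ w (d j) ≠ w' (d j) := by
    intro w w' j
    simp [hτ]
  have hτinj : τ.Injective := by
    intro w w' h
    funext k
    obtain ⟨j, rfl⟩ := hdbij.2 k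
    exact not_not.1 (mt (hτne w w' j).2 (by rw [h]; simp))
  have hτv : τ v = fun _ => false := by funext j; simp [hτ]
  have hτ0 : ∀ w, w ≠ v → τ w ≠ fun _ => false := fun w hw h => hw (hτinj (h.trans hτv.symm))
  have hτadj : ∀ w w', cube.Adj (τ w) (τ w') ↔ cube.Adj w w' := by
    intro w w'
    change (∃! j, τ w j ≠ τ w' j) ↔ ∃! i, w i ≠ w' i
    exact e.existsUnique_congr fun j => hτne w w' j
  have hτσ : ∀ i, τ (σ.symm i : Fin 3 → Bool) = fun k => decide (k = i) := by
    intro i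
    funext k
    by_cases hk : k = i
    · subst hk
      have := hd k
      simp only [hτ, decide_true]
      revert this
      cases v (d k) <;> cases (σ.symm k : Fin 3 → Bool) (d k) <;> simp
    · have := not_not.1 (mt (hd' i (d k)) (hdinj.ne hk))
      simp [hτ, this, hk]
  have houter : ∀ (x : {w // w ≠ v}) (g : Gadget),
      expandedCube.Adj (cubeCode (τ x)) (gadgetCode g) ↔
        ∃ i, g = .outer i ∧ (σ.symm i : Fin 3 → Bool) = x := by
    intro x g
    have h := cubeCode_not_adj (τ x) (hτ0 x x.2)
    rcases g with _ | i | i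
    · simpa using h.1
    · simpa using h.2 i
    · rw [cubeCode_adj_outer _ (hτ0 x x.2), ← hτσ, hτinj.eq_iff]
      simp [eq_comm]
  set φ : {w // w ≠ v} ⊕ Gadget → Fin 14 := Sum.elim (fun x => cubeCode (τ x)) gadgetCode with hφ
  have hφinj : φ.Injective := by
    rintro (x | g) (y | h) hxy <;> simp only [hφ, Sum.elim_inl, Sum.elim_inr] at hxy
    · exact congrArg _ (Subtype.ext (hτinj (cubeCode_inj _ _ hxy)))
    · exact absurd hxy (cubeCode_ne_gadgetCode _ (hτ0 x x.2) h)
    · exact absurd hxy.symm (cubeCode_ne_gadgetCode _ (hτ0 y y.2) g)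
    · exact congrArg _ (gadgetCode_inj hxy)
  have hφbij : φ.Bijective :=
    (Nat.bijective_iff_injective_and_card φ).2 ⟨hφinj, by rw [card_cubeExpansion]; simp⟩
  refine ⟨⟨Equiv.ofBijective φ hφbij, ?_⟩⟩
  rintro (x | g) (y | h)
  · exact (cubeCode_adj _ _ (hτ0 x x.2) (hτ0 y y.2)).trans (hτadj x y)
  · exact houter x h
  · exact (expandedCube.adj_comm _ _).trans (houter y g)
  · exact gadgetCode_adj g h

end CubeExpansion

/-! ### The cut around the gadget -/

section GadgetCut

variable {V : Type*} (G : SimpleGraph V) (v : V) (σ : G.neighborSet v ≃ Fin 3)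

/-- In terms of a perfect matching, `A k` says that the centre is matched to inner `k`, `B i j` that
inner `i` is matched to outer `j`, and `D j` that outer `j` is matched outside the gadget. The
centre uses up one inner vertex, the other two use up two outer vertices, and one outer vertex is
left. -/
theorem existsUnique_outer {A D : Fin 3 → Prop} {B : Fin 3 → Fin 3 → Prop}
    (hA : ∃ k, A k) (hA' : ∀ k l, A k → A l → k = l)
    (hB : ∀ i, A i ∨ ∃ j, i ≠ j ∧ B i j) (hAB : ∀ i j, A i → ¬ B i j)
    (hB1 : ∀ i j k, B i j → B i k → j = k) (hB2 : ∀ i j k, B i k → B j k → i = j)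
    (hD : ∀ j, D j ∨ ∃ i, i ≠ j ∧ B i j) (hBD : ∀ i j, B i j → ¬ D j) : ∃! m, D m := by
  obtain ⟨k, hk⟩ := hA
  have hB' : ∀ i, i ≠ k → ∃ j, i ≠ j ∧ B i j := fun i hi =>
    (hB i).resolve_left fun h => hi (hA' i k h hk)
  obtain ⟨a, b, hak, hbk, hab, hall⟩ : ∃ a b, a ≠ k ∧ b ≠ k ∧ a ≠ b ∧
      ∀ i, i = k ∨ i = a ∨ i = b := by
    clear * -
    revert k; decide
  obtain ⟨x, -, hx⟩ := hB' a hak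
  obtain ⟨y, -, hy⟩ := hB' b hbk
  have hxy : x ≠ y := fun h => hab (hB2 a b x hx (h ▸ hy))
  obtain ⟨m, hmx, hmy, hm⟩ : ∃ m, m ≠ x ∧ m ≠ y ∧ ∀ i, i = m ∨ i = x ∨ i = y := by
    clear * - hxy
    revert x y; decide
  refine ⟨m, (hD m).resolve_right ?_, fun l hl => ?_⟩
  · rintro ⟨i, -, hi⟩
    rcases hall i with rfl | rfl | rfl
    · exact hAB _ _ hk hi
    · exact hmx (hB1 _ _ _ hi hx)
    · exact hmy (hB1 _ _ _ hi hy)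
  · rcases hm l with rfl | rfl | rfl
    · rfl
    · exact absurd hl (hBD _ _ hx)
    · exact absurd hl (hBD _ _ hy)

/-- The cut around the gadget of a cube-expansion is tight. -/
theorem isTightCut_gadget :
    IsTightCut (cubeExpansion G v σ) (cutAround (cubeExpansion G v σ) (Set.range Sum.inr)) := by
  refine ⟨⟨_, rfl⟩, fun M hM => ?_⟩
  have hpart : ∀ x, ∃! y, M.Adj x y := fun x => hM.1 (hM.2 x)
  have huniq : ∀ x y z, M.Adj x y → M.Adj x z → y = z := fun x y z h h' => (hpart x).unique h h'
  have hin : ∀ i y, M.Adj (.inr (.inner i)) y →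
      y = .inr .centre ∨ ∃ j, i ≠ j ∧ y = .inr (.outer j) := by
    intro i y h
    have h' := M.adj_sub h
    rcases y with y | _ | j | j
    · obtain ⟨k, hk, -⟩ := h'
      cases hk
    · exact Or.inl rfl
    · exact h'.elim
    · exact Or.inr ⟨j, h', rfl⟩
  have hcen : ∀ y, M.Adj (.inr .centre) y → ∃ k, y = .inr (.inner k) := by
    intro y h
    have h' := M.adj_sub h
    rcases y with y | _ | j | j
    · obtain ⟨k, hk, -⟩ := h'
      cases hk
    · exact h'.elim
    · exact ⟨j, rfl⟩
    · exact h'.elim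
  have hout : ∀ j y, M.Adj (.inr (.outer j)) y →
      (∃ x, y = .inl x) ∨ ∃ i, i ≠ j ∧ y = .inr (.inner i) := by
    intro j y h
    have h' := M.adj_sub h
    rcases y with y | _ | i | i
    · exact Or.inl ⟨y, rfl⟩
    · exact h'.elim
    · exact Or.inr ⟨i, Ne.symm (show j ≠ i from h'), rfl⟩
    · exact h'.elim
  obtain ⟨m, ⟨x, hx⟩, hm⟩ := existsUnique_outer
    (A := fun k => M.Adj (.inr .centre) (.inr (.inner k)))
    (B := fun i j => M.Adj (.inr (.inner i)) (.inr (.outer j)))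
    (D := fun j => ∃ x, M.Adj (.inr (.outer j)) (.inl x))
    (by
      obtain ⟨y, hy, -⟩ := hpart (.inr .centre)
      obtain ⟨k, rfl⟩ := hcen y hy
      exact ⟨k, hy⟩)
    (fun k l h h' => by simpa using huniq _ _ _ h h')
    (fun i => by
      obtain ⟨y, hy, -⟩ := hpart (.inr (.inner i))
      rcases hin i y hy with rfl | ⟨j, hij, rfl⟩
      · exact Or.inl hy.symm
      · exact Or.inr ⟨j, hij, hy⟩)
    (fun i j h h' => by simpa using huniq _ _ _ h.symm h')
    (fun i j k h h' => by simpa using huniq _ _ _ h h')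
    (fun i j k h h' => by simpa using huniq _ _ _ h.symm h'.symm)
    (fun j => by
      obtain ⟨y, hy, -⟩ := hpart (.inr (.outer j))
      rcases hout j y hy with ⟨x, rfl⟩ | ⟨i, hij, rfl⟩
      · exact Or.inl ⟨x, hy⟩
      · exact Or.inr ⟨i, hij, hy.symm⟩)
    (fun i j h ⟨x, h'⟩ => by simpa using huniq _ _ _ h.symm h')
  rw [Set.ncard_eq_one]
  refine ⟨s(.inr (.outer m), .inl x), Set.eq_singleton_iff_unique_mem.2 ⟨?_, ?_⟩⟩
  · exact ⟨mk_mem_cutAround.2 ⟨M.adj_sub hx, by simp⟩, hx⟩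
  · rintro e ⟨⟨a, b, hab, ⟨g, rfl⟩, hb, rfl⟩, he⟩
    rcases b with y | g'
    · obtain ⟨i, rfl, -⟩ := hab
      obtain rfl := hm i ⟨y, he⟩
      rw [huniq (.inr (.outer i)) (.inl y) (.inl x) he hx]
    · exact absurd ⟨g', rfl⟩ hb

/-- The cut around the gadget of a cube-expansion of the cube is non-trivial. -/
theorem isNontrivialCut_gadget (v : Fin 3 → Bool) (σ : cube.neighborSet v ≃ Fin 3) :
    IsNontrivialCut (cubeExpansion cube v σ)
      (cutAround (cubeExpansion cube v σ) (Set.range Sum.inr)) := by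
  have hne : ∀ i, (σ.symm i : Fin 3 → Bool) ≠ v := fun i => cube.ne_of_adj (σ.symm i).2.symm
  refine ⟨_, rfl, ⟨.inr .centre, ⟨_, rfl⟩, .inr (.inner 0), ⟨_, rfl⟩, by simp⟩,
    .inl ⟨σ.symm 0, hne 0⟩, by simp, .inl ⟨σ.symm 1, hne 1⟩, by simp, ?_⟩
  simp [Subtype.val_inj]

end GadgetCut

end Barnette

theorem mainTheorem9 :
    (∀ {V : Type*} (G : SimpleGraph V), Barnette.InBarnetteClass G →
      ∀ F : Set (Set (Sym2 V)), Barnette.IsMaximalLaminarTightFamily G F →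
        (F.ncard : ℚ) ≤ ((Nat.card V : ℚ) - 8) / 6) ∧
    (∀ (v : Fin 3 → Bool) (σ : Barnette.cube.neighborSet v ≃ Fin 3),
      Barnette.InBarnetteClass (Barnette.cubeExpansion Barnette.cube v σ) ∧
      ∃ F, Barnette.IsMaximalLaminarTightFamily (Barnette.cubeExpansion Barnette.cube v σ) F ∧
        (F.ncard : ℚ) =
          ((Nat.card ({w : Fin 3 → Bool // w ≠ v} ⊕ Barnette.Gadget) : ℚ) - 8) / 6) := by
  refine ⟨fun G hG F hF => ?_, fun v σ => ?_⟩
  · have h : ((6 * F.ncard + 8 : ℕ) : ℚ) ≤ Nat.card _ :=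
      Nat.cast_le.2 (hF.prop.six_mul_ncard_add_eight_le hG)
    push_cast at h
    linarith
  · obtain ⟨e⟩ := Barnette.nonempty_iso_expandedCube v σ
    have hH := Barnette.inBarnetteClass_expandedCube.of_iso e
    have := hH.finite
    set C := Barnette.cutAround (Barnette.cubeExpansion Barnette.cube v σ) (Set.range Sum.inr)
    refine ⟨hH, {C}, ⟨⟨?_, Set.pairwise_singleton _ _⟩, fun F' hF' hle => ?_⟩, ?_⟩
    · rintro _ rfl
      exact ⟨Barnette.isTightCut_gadget _ v σ, Barnette.isNontrivialCut_gadget v σ⟩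
    -- On 14 vertices the bound allows one cut only, so a family containing `C` is `{C}`.
    · have h := hF'.six_mul_ncard_add_eight_le hH
      rw [Barnette.card_cubeExpansion] at h
      exact (Set.eq_of_subset_of_ncard_le hle (by rw [Set.ncard_singleton]; omega)).ge
    · rw [Barnette.card_cubeExpansion, Set.ncard_singleton]
      norm_num
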